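/- **Setting.** Let $G$ be a discrete group and $\Gamma\subseteq G$ an almost normal subgroup, i.e. $[\Gamma:\Gamma\cap\sigma\Gamma\sigma^{-1}]<\infty$ for all $\sigma\in G$. For $i=1,2$ let $\pi_i$ be a projective unitary representation of $G$ on a Hilbert space $H_i$, both with the same multiplier $c:G\times G\to\mathbb T$, so $\pi_i(g)\pi_i(h)=c(g,h)\pi_i(gh)$, where $c=1$ on $\Gamma\times\Gamma$ (for $c=1$ these are two unitary representations). Let $L_i\subseteq H_i$ be a closed subspace that is $\Gamma$-wandering ($\pi_i(\gamma)L_i\perp L_i$ for $\gamma\in\Gamma\setminus\{e\}$) and generating (the span of $\bigcup_{\gamma\in\Gamma}\pi_i(\gamma)L_i$ is dense), with orthogonal projection $P_{L_i}$; thus $H_i\cong\ell^2(\Gamma)\otimes L_i$ by $\pi_i(\gamma)l\leftrightarrow\delta_\gamma\otimes l$. *Convolutors.* On $\ell^2(G)$ put $\rho(\theta^{-1})\delta_h=\overline{c(h\theta^{-1},\theta)}\,\delta_{h\theta^{-1}}$ (for $c=1$: $\rho(a)\delta_h=\delta_{ha}$). $R(G)\otimes B(L_1,L_2)$ denotes the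 bounded operators $\ell^2(G)\otimes L_1\to\ell^2(G)\otimes L_2$ of the form $\sum_{\theta}\rho(\theta^{-1})\otimes A_\theta$, $A_\theta\in B(L_1,L_2)$, in the sense of matrix entries; likewise for $\Gamma$ (where $c=1$). The canonical conditional expectation $E:R(G)\otimes B(L_1,L_2)\to R(\Gamma)\otimes B(L_1,L_2)$ is the compression to $\ell^2(\Gamma)$; it keeps the coefficients with $\theta\in\Gamma$. *Series and character.* For a projective unitary representation $\pi$ of $G$ on $H$, a closed subspace $L$ and $A\subseteq G$ let $S(A)=\sum_{\theta\in A}\rho(\theta^{-1})\otimes P_L\pi(\theta)P_L$ (a formal series); write $S_1,S_2,S$ for $(\pi_1,L_1)$, $(\pi_2,L_2)$ and the pair $(\pi,L)$ below. Let $\widetilde\varepsilon(\sum\rho(\theta^{-1})\otimes A_\theta)=\sum_\theta A_\theta$; this is densely defined: its value is the bounded operator $T$ if $\sum_\theta A_\theta v$ converges unconditionally to $Tv$ for all $v$ in a dense set. *Intertwiners.* $\mathrm{Int}_\Gamma=\{X\in B(H_1,H_2): X\pi_1(\gamma)=\pi_2(\gamma)X,\ \gamma\in\Gamma\}$, and $\tau(A)=\mathrm{Tr}(P_{L_i}AP_{L_i})$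 for positive $A\in\pi_i(\Gamma)'$ (the trace $\tau_{R(\Gamma)}\otimes\mathrm{Tr}$). Let $\pi(g)Y=\pi_2(g)Y\pi_1(g)^{-1}$ be the diagonal representation of $G$ on the Hilbert space $\mathcal C_2(H_1,H_2)\cong H_1\otimes\overline H_2$ (up to conjugation) of Hilbert–Schmidt operators, and $L=\{Y\in\mathcal C_2(H_1,H_2):Y=YP_{L_1}\}$. For $\sigma\in G$ and $X\in\mathrm{Int}_\Gamma$ let $\Psi(\Gamma\sigma\Gamma)(X)=\sum_t\pi_2(t)X\pi_1(t)^{-1}$, $t$ running over representatives of the left cosets $t\Gamma\subseteq\Gamma\sigma\Gamma$. **Statement.** Let $\sigma\in G$. 1. $\Gamma\sigma\Gamma$ is a finite disjoint union $\bigcup_i s_i\sigma\Gamma$ with $s_i\in\Gamma$, and for each such decomposition $\Psi(\Gamma\sigma\Gamma)(X)=\sum_i\pi_2(s_i\sigma)X\pi_1(s_i\sigma)^{-1}$ for $X\in\mathrm{Int}_\Gamma$; moreover $\Psi(\Gamma\sigma\Gamma)$ maps $\mathrm{Int}_\Gamma$ into itself. 2. $L$ is a $\Gamma$-wandering generating subspace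 for $\pi$, and it is the space $L^2(\mathrm{Int}_\Gamma,\tau)$: for $X\in\mathrm{Int}_\Gamma$ we have $\|XP_{L_1}\|_2^2=\tau(X^*X)=\tau(XX^*)$ (possibly $\infty$) and $X=\sum_{\gamma\in\Gamma}\pi_2(\gamma)XP_{L_1}\pi_1(\gamma)^{-1}$ strongly, and the vectors $XP_{L_1}$ with $X\in\mathrm{Int}_\Gamma$, $\tau(X^*X)<\infty$, are dense in $L$. 3. There is a bounded operator on $L$, also written $\Psi(\Gamma\sigma\Gamma)$, which extends $\Psi(\Gamma\sigma\Gamma)$: if $X\in\mathrm{Int}_\Gamma$ and $\tau(X^*X)<\infty$, then $\Psi(\Gamma\sigma\Gamma)(X)P_{L_1}$ is Hilbert–Schmidt and is the image of $XP_{L_1}$. It satisfies $$\widetilde\varepsilon\big(S(\Gamma\sigma\Gamma)\big)=\sum_{\theta\in\Gamma\sigma\Gamma}P_L\pi(\theta)P_L=\Psi(\Gamma\sigma\Gamma).$$ More precisely, for every $X\in\mathrm{Int}_\Gamma$ such that $XP_{L_1}$ has finite rank, the sum converges unconditionally in Hilbert–Schmidt norm at the vector $XP_{L_1}$, and for every $Y\in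 L$ the sum of the inner products $\langle XP_{L_1},P_L\pi(\theta)Y\rangle$ converges unconditionally to $\langle XP_{L_1},\Psi(\Gamma\sigma\Gamma)Y\rangle$. 4. Under $H_i\cong\ell^2(\Gamma)\otimes L_i$ the space $\mathrm{Int}_\Gamma$ is $R(\Gamma)\otimes B(L_1,L_2)$, and $X\in\mathrm{Int}_\Gamma$ corresponds to $\sum_{\gamma\in\Gamma}\rho(\gamma^{-1})\otimes P_{L_2}\pi_2(\gamma)XP_{L_1}$; the same series defines an element of $R(G)\otimes B(L_1,L_2)$. The series $S_i(\Gamma\sigma\Gamma)$ belong to $R(G)\otimes B(L_i)$, $S_1(\Gamma\sigma\Gamma)^*=S_1(\Gamma\sigma^{-1}\Gamma)$, and for all $X\in\mathrm{Int}_\Gamma\cong R(\Gamma)\otimes B(L_1,L_2)$ $$\Psi(\Gamma\sigma\Gamma)(X)=E\big(S_2(\Gamma\sigma\Gamma)\,X\,S_1(\Gamma\sigma\Gamma)^*\big).$$ In particular, if $\Gamma\sigma\Gamma=\Gamma\sigma^{-1}\Gamma$, then $\Psi(\Gamma\sigma\Gamma)(X)=E\big(S_2(\Gamma\sigma\Gamma)\,X\,S_1(\Gamma\sigma\Gamma)\big)$.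 -/

import Mathlib

open scoped InnerProductSpace ENNReal Pointwise

noncomputable section

namespace HeckeRep

/-! ### Projective unitary representations and wandering subspaces -/

/-- A projective unitary representation of `G` on `H` with multiplier `c`:
unitaries `π g` with `π g π h = c g h • π (g h)`. For `c = 1` this is a unitary representation. -/
structure ProjRep (G : Type*) [Group G] (H : Type*) [NormedAddCommGroup H] [InnerProductSpace ℂ H]
    (c : G → G → Circle) where
  toFun : G → H ≃ₗᵢ[ℂ] H
  mul_apply : ∀ g h x, toFun g (toFun h x) = (c g h : ℂ) • toFun (g * h) x

/-- `Γ` is almost normal in `G`: for all `σ`, the index of `Γ ∩ σΓσ⁻¹` in `Γ` is finite. -/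
def IsAlmostNormal {G : Type*} [Group G] (Γ : Subgroup G) : Prop :=
  ∀ σ : G, (Γ.map (MulAut.conj σ).toMonoidHom).relIndex Γ ≠ 0

section Wandering

variable {G : Type*} [Group G] {H : Type*} [NormedAddCommGroup H] [InnerProductSpace ℂ H]
  {c : G → G → Circle}

/-- The subspace `L` is `Γ`-wandering (`π γ L ⊥ L` for `γ ≠ e`) and generating
(the span of the `π γ L`, `γ ∈ Γ`, is dense). -/
structure IsWandering (π : ProjRep G H c) (Γ : Subgroup G) (L : Submodule ℂ H) : Prop where
  ortho : ∀ γ ∈ Γ, γ ≠ 1 → ∀ x ∈ L, ∀ y ∈ L, ⟪π.toFun γ x, y⟫_ℂ = 0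
  dense : (⨆ γ : Γ, L.map (π.toFun γ).toLinearEquiv.toLinearMap).topologicalClosure = ⊤

theorem IsWandering.isHilbertSum {π : ProjRep G H c} {Γ : Subgroup G} {L : Submodule ℂ H}
    [CompleteSpace L] [CompleteSpace H] (hL : IsWandering π Γ L) :
    IsHilbertSum ℂ (fun _ : Γ => L)
      (fun γ : Γ => (π.toFun γ).toLinearIsometry.comp L.subtypeₗᵢ) := by
  refine IsHilbertSum.mk ?_ ?_
  · intro γ γ' hne x y
    have hne' : ((γ' : G)⁻¹ * γ) ≠ 1 := by
      intro h
      apply hne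
      ext
      exact (inv_mul_eq_one.mp h).symm
    have h := hL.ortho _ (Γ.mul_mem (Γ.inv_mem γ'.2) γ.2) hne' x x.2 y y.2
    have h2 := π.mul_apply γ' ((γ' : G)⁻¹ * γ) (x : H)
    have h5 : (γ' : G) * ((γ' : G)⁻¹ * γ) = γ := mul_inv_cancel_left _ _
    rw [h5] at h2
    have h3 : ⟪π.toFun γ' (π.toFun ((γ' : G)⁻¹ * γ) x), π.toFun γ' (y : H)⟫_ℂ = 0 := by
      rw [LinearIsometryEquiv.inner_map_map, h]
    rw [h2, inner_smul_left] at h3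
    have h4 : (starRingEnd ℂ) (c γ' ((γ' : G)⁻¹ * γ) : ℂ) ≠ 0 := by simp
    simpa using (mul_eq_zero.mp h3).resolve_left h4
  · have h := hL.dense
    rw [← h]
    apply Submodule.topologicalClosure_mono
    apply iSup_mono
    intro γ
    rintro _ ⟨x, hx, rfl⟩
    exact ⟨⟨x, hx⟩, rfl⟩

/-- The identification `H ≅ ℓ²(Γ) ⊗ L = ℓ²(Γ; L)` given by a wandering generating subspace:
the inverse sends `δ_γ ⊗ l` to `π γ l`. -/
def IsWandering.equiv {π : ProjRep G H c} {Γ : Subgroup G} {L : Submodule ℂ H}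
    [CompleteSpace L] [CompleteSpace H] (hL : IsWandering π Γ L) :
    H ≃ₗᵢ[ℂ] lp (fun _ : Γ => L) 2 :=
  hL.isHilbertSum.linearIsometryEquiv

/-- The formal series `S(A) = ∑_{θ ∈ A} ρ(θ⁻¹) ⊗ P_L π(θ) P_L`, stored as the function sending
`θ` to the coefficient of `ρ(θ⁻¹)`. -/
def series (π : ProjRep G H c) (L : Submodule ℂ H) [L.HasOrthogonalProjection] (A : Set G) :
    G → L →L[ℂ] L :=
  A.indicator fun θ =>
    L.orthogonalProjectionOnto ∘L (π.toFun θ).toContinuousLinearEquiv.toContinuousLinearMap ∘L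
      L.subtypeL

end Wandering

/-- `ε̃`: the sum of the coefficients of a formal series. It is densely defined; the bounded
operator `T` is its value at `∑ ρ(θ⁻¹) ⊗ A θ` when `∑ A θ` converges (unconditionally) to `T`
strongly on a dense subspace. -/
def IsCharacterValue {G K : Type*} [NormedAddCommGroup K] [NormedSpace ℂ K]
    (A : G → K →L[ℂ] K) (T : K →L[ℂ] K) : Prop :=
  Dense {v : K | HasSum (fun θ => A θ v) (T v)}

/-! ### Convolution operators on `ℓ²(G) ⊗ L` -/

section Convolution

variable {G : Type*} [Group G] {L₁ L₂ : Type*} [NormedAddCommGroup L₁] [InnerProductSpace ℂ L₁]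
  [NormedAddCommGroup L₂] [InnerProductSpace ℂ L₂]

open Classical in
/-- The bounded operator `T : ℓ²(G; L₁) → ℓ²(G; L₂)` is the right convolutor
`∑ ρ(θ⁻¹) ⊗ A θ`, where `ρ(θ⁻¹) δ_h = conj (c (h θ⁻¹) θ) δ_{h θ⁻¹}`
(for `c = 1` this is the right regular representation `ρ(a) δ_h = δ_{h a}`).
The bounded operators that represent some `A` form `R(G) ⊗ B(L₁, L₂)`. -/
def Represents (c : G → G → Circle) (A : G → L₁ →L[ℂ] L₂)
    (T : lp (fun _ : G => L₁) 2 →L[ℂ] lp (fun _ : G => L₂) 2) : Prop :=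
  ∀ (h : G) (l : L₁) (k : G),
    T (lp.single 2 h l) k = (starRingEnd ℂ (c k (k⁻¹ * h) : ℂ)) • A (k⁻¹ * h) l

/-- Restriction `ℓ²(G; L) → ℓ²(Γ; L)`; its adjoint is extension by zero. -/
def restrict (Γ : Subgroup G) (L : Type*) [NormedAddCommGroup L] [InnerProductSpace ℂ L] :
    lp (fun _ : G => L) 2 →L[ℂ] lp (fun _ : Γ => L) 2 :=
  LinearMap.mkContinuous
    { toFun := fun f => ⟨fun γ : Γ => f γ, by
        have h := (memℓp_gen_iff (by norm_num : 0 < (2 : ℝ≥0∞).toReal)).1 f.2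
        exact (memℓp_gen_iff (by norm_num)).2 (h.comp_injective Subtype.val_injective)⟩
      map_add' := fun _ _ => rfl
      map_smul' := fun _ _ => rfl } 1 (by
    intro f
    rw [one_mul]
    refine lp.norm_le_of_tsum_le (by norm_num) (norm_nonneg _) ?_
    rw [lp.norm_rpow_eq_tsum (by norm_num) f]
    have h := (memℓp_gen_iff (by norm_num : 0 < (2 : ℝ≥0∞).toReal)).1 f.2
    exact h.tsum_subtype_le (fun i => ‖f i‖ ^ (2 : ℝ≥0∞).toReal) Γ (fun i => by positivity))

/-- The canonical conditional expectation `R(G) ⊗ B(L₁, L₂) → R(Γ) ⊗ B(L₁, L₂)`, with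
`R(Γ) ⊗ B(L₁, L₂)` acting from `ℓ²(Γ; L₁)` to `ℓ²(Γ; L₂)`: compression to `ℓ²(Γ)`. On
convolutors it keeps the coefficients in `Γ` and discards the other ones. -/
def condExp (Γ : Subgroup G) [CompleteSpace L₁]
    (T : lp (fun _ : G => L₁) 2 →L[ℂ] lp (fun _ : G => L₂) 2) :
    lp (fun _ : Γ => L₁) 2 →L[ℂ] lp (fun _ : Γ => L₂) 2 :=
  restrict Γ L₂ ∘L T ∘L ContinuousLinearMap.adjoint (restrict Γ L₁)

end Convolution

/-! ### Intertwiners and Hecke operators -/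

section Intertwiners

variable {G : Type*} [Group G]
  {H₁ : Type*} [NormedAddCommGroup H₁] [InnerProductSpace ℂ H₁]
  {H₂ : Type*} [NormedAddCommGroup H₂] [InnerProductSpace ℂ H₂]
  {c : G → G → Circle}

/-- `Int_Γ(π₁, π₂)`: the bounded operators `X` with `X π₁(γ) = π₂(γ) X` for `γ ∈ Γ`. -/
def intertwiners (π₁ : ProjRep G H₁ c) (π₂ : ProjRep G H₂ c) (Γ : Subgroup G) :
    Submodule ℂ (H₁ →L[ℂ] H₂) where
  carrier := {X | ∀ γ ∈ Γ, ∀ x, X (π₁.toFun γ x) = π₂.toFun γ (X x)}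
  add_mem' := fun hX hY γ hγ x => by simp [hX γ hγ x, hY γ hγ x]
  zero_mem' := fun γ _ x => by simp
  smul_mem' := fun a X hX γ hγ x => by simp [hX γ hγ x]

/-- `X ↦ π₂(g) X π₁(g)⁻¹`. -/
def conjOp (π₁ : ProjRep G H₁ c) (π₂ : ProjRep G H₂ c) (g : G) (X : H₁ →L[ℂ] H₂) : H₁ →L[ℂ] H₂ :=
  (π₂.toFun g).toContinuousLinearEquiv.toContinuousLinearMap ∘L X ∘L
    (π₁.toFun g).symm.toContinuousLinearEquiv.toContinuousLinearMap

/-- The elements `s i σ` are representatives of the left cosets of `Γ` in `ΓσΓ`: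
`ΓσΓ` is the disjoint union of the `s i σ Γ`, with `s i ∈ Γ`. -/
structure IsCosetDecomposition (Γ : Subgroup G) (σ : G) {ι : Type*} (s : ι → G) : Prop where
  mem : ∀ i, s i ∈ Γ
  union : DoubleCoset.doubleCoset σ Γ Γ = ⋃ i, (s i * σ) • (Γ : Set G)
  disjoint : Pairwise fun i j => Disjoint ((s i * σ) • (Γ : Set G)) ((s j * σ) • (Γ : Set G))

/-- The classical Hecke operator `Ψ(ΓσΓ)`: the sum of `π₂(t) X π₁(t)⁻¹` over representatives `t`
of the left cosets `tΓ` contained in `ΓσΓ`. -/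
def hecke (π₁ : ProjRep G H₁ c) (π₂ : ProjRep G H₂ c) (Γ : Subgroup G) (σ : G)
    (X : H₁ →L[ℂ] H₂) : H₁ →L[ℂ] H₂ :=
  ∑ᶠ (q : G ⧸ Γ) (_ : q.out ∈ DoubleCoset.doubleCoset σ (Γ : Set G) Γ), conjOp π₁ π₂ q.out X

/-- The coefficients `x γ = P_{L₂} π₂(γ) X P_{L₁}` of an intertwiner
`X ≅ ∑_{γ ∈ Γ} ρ(γ⁻¹) ⊗ x γ`. -/
def intCoeff (π₂ : ProjRep G H₂ c) (Γ : Subgroup G) (L₁ : Submodule ℂ H₁) (L₂ : Submodule ℂ H₂)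
    [L₂.HasOrthogonalProjection] (X : H₁ →L[ℂ] H₂) (γ : Γ) : L₁ →L[ℂ] L₂ :=
  L₂.orthogonalProjectionOnto ∘L
    (π₂.toFun γ).toContinuousLinearEquiv.toContinuousLinearMap ∘L X ∘L L₁.subtypeL

/-- An operator `X : H₁ → H₂` seen through the identifications `H_i ≅ ℓ²(Γ; L_i)`. -/
def transport {π₁ : ProjRep G H₁ c} {π₂ : ProjRep G H₂ c} {Γ : Subgroup G}
    {L₁ : Submodule ℂ H₁} {L₂ : Submodule ℂ H₂} [CompleteSpace H₁] [CompleteSpace H₂]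
    [CompleteSpace L₁] [CompleteSpace L₂] (h₁ : IsWandering π₁ Γ L₁) (h₂ : IsWandering π₂ Γ L₂)
    (X : H₁ →L[ℂ] H₂) : lp (fun _ : Γ => L₁) 2 →L[ℂ] lp (fun _ : Γ => L₂) 2 :=
  h₂.equiv.toContinuousLinearEquiv.toContinuousLinearMap ∘L X ∘L
    h₁.equiv.symm.toContinuousLinearEquiv.toContinuousLinearMap

open Classical in
/-- Coefficients indexed by `Γ`, extended by zero to `G`; this is the inclusion
`R(Γ) ⊗ B(L₁, L₂) ⊆ R(G) ⊗ B(L₁, L₂)` at the level of coefficients. -/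
def extendZero (Γ : Subgroup G) {M : Type*} [Zero M] (A : Γ → M) (g : G) : M :=
  if h : g ∈ Γ then A ⟨g, h⟩ else 0

end Intertwiners

/-! ### Hilbert–Schmidt operators -/

section HilbertSchmidt

variable (H₁ : Type*) [NormedAddCommGroup H₁] [InnerProductSpace ℂ H₁] [CompleteSpace H₁]
  (H₂ : Type*) [NormedAddCommGroup H₂] [InnerProductSpace ℂ H₂] [CompleteSpace H₂]

/-- The index set of a fixed Hilbert basis of `H₁`. -/
def basisIdx : Set H₁ := (exists_hilbertBasis ℂ H₁).choose

/-- A fixed Hilbert basis of `H₁`. -/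
def stdBasis : HilbertBasis (basisIdx H₁) ℂ H₁ := (exists_hilbertBasis ℂ H₁).choose_spec.choose

variable {H₁ H₂}

/-- The square of the Hilbert–Schmidt norm, `∑ ‖X e_i‖²`. -/
def hsSq (X : H₁ →L[ℂ] H₂) : ℝ≥0∞ := ∑' i, ‖X (stdBasis H₁ i)‖ₑ ^ 2

/-- `X` is a Hilbert–Schmidt operator. -/
def IsHS (X : H₁ →L[ℂ] H₂) : Prop := hsSq X < ⊤

theorem parseval {ι : Type*} (b : HilbertBasis ι ℂ H₁) (x : H₁) :
    ∑' i, ‖⟪b i, x⟫_ℂ‖ₑ ^ 2 = ‖x‖ₑ ^ 2 := by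
  have h := lp.norm_rpow_eq_tsum (p := 2) (by norm_num) (b.repr x)
  have hs := (memℓp_gen_iff (by norm_num : 0 < (2 : ℝ≥0∞).toReal)).1 (b.repr x).2
  simp only [LinearIsometryEquiv.norm_map, ENNReal.toReal_ofNat, Real.rpow_ofNat,
    HilbertBasis.repr_apply_apply] at h hs
  have e : ∀ {E : Type _} [NormedAddCommGroup E] (y : E), ‖y‖ₑ ^ 2 = ENNReal.ofReal (‖y‖ ^ 2) := by
    intro E _ y
    rw [ENNReal.ofReal_pow (norm_nonneg _), ofReal_norm]
  have e' : ∀ y : ℂ, ‖y‖ₑ ^ 2 = ENNReal.ofReal (‖y‖ ^ 2) := by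
    intro y
    rw [ENNReal.ofReal_pow (norm_nonneg _), ofReal_norm]
  rw [e, h, ENNReal.ofReal_tsum_of_nonneg (fun i => by positivity) hs]
  exact tsum_congr fun i => e' _

theorem tsum_basis_eq_adjoint {ι κ : Type*} (b : HilbertBasis ι ℂ H₁) (d : HilbertBasis κ ℂ H₂)
    (X : H₁ →L[ℂ] H₂) :
    ∑' i, ‖X (b i)‖ₑ ^ 2 = ∑' j, ‖ContinuousLinearMap.adjoint X (d j)‖ₑ ^ 2 := by
  simp_rw [← parseval d (X _), ← parseval b (ContinuousLinearMap.adjoint X _)]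
  rw [ENNReal.tsum_comm]
  refine tsum_congr fun j => tsum_congr fun i => ?_
  rw [ContinuousLinearMap.adjoint_inner_right, ← inner_conj_symm (X (b i)) (d j),
    RCLike.enorm_conj]

/-- The Hilbert–Schmidt norm can be computed in any Hilbert basis. -/
theorem hsSq_eq {ι : Type*} (b : HilbertBasis ι ℂ H₁) (X : H₁ →L[ℂ] H₂) :
    hsSq X = ∑' i, ‖X (b i)‖ₑ ^ 2 := by
  rw [hsSq, tsum_basis_eq_adjoint _ (stdBasis H₂), tsum_basis_eq_adjoint b (stdBasis H₂)]

theorem hsSq_adjoint (X : H₁ →L[ℂ] H₂) : hsSq (ContinuousLinearMap.adjoint X) = hsSq X :=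
  (tsum_basis_eq_adjoint _ _ _).symm

theorem enorm_apply_sq_le (X : H₁ →L[ℂ] H₂) (x : H₁) : ‖X x‖ₑ ^ 2 ≤ hsSq X * ‖x‖ₑ ^ 2 := by
  rw [← hsSq_adjoint, hsSq, ← ENNReal.tsum_mul_right, ← parseval (stdBasis H₂)]
  refine ENNReal.tsum_le_tsum fun i => ?_
  rw [← ContinuousLinearMap.adjoint_inner_left, ← mul_pow]
  gcongr
  rw [← ofReal_norm, ← ofReal_norm, ← ofReal_norm, ← ENNReal.ofReal_mul (norm_nonneg _)]
  exact ENNReal.ofReal_le_ofReal (norm_inner_le_norm _ _)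

theorem hsSq_conj (U : H₂ ≃ₗᵢ[ℂ] H₂) (V : H₁ ≃ₗᵢ[ℂ] H₁) (X : H₁ →L[ℂ] H₂) :
    hsSq (U.toContinuousLinearEquiv.toContinuousLinearMap ∘L X ∘L
      V.toContinuousLinearEquiv.toContinuousLinearMap) = hsSq X := by
  rw [hsSq_eq (HilbertBasis.ofRepr (V.trans (stdBasis H₁).repr)), hsSq]
  refine tsum_congr fun i => ?_
  classical
  rw [← HilbertBasis.repr_symm_single, ← HilbertBasis.repr_symm_single]
  simp [enorm_eq_nnnorm]

theorem isHS_iff_memℓp (X : H₁ →L[ℂ] H₂) :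
    IsHS X ↔ Memℓp (fun i => X (stdBasis H₁ i)) 2 := by
  rw [memℓp_gen_iff (by norm_num), IsHS, hsSq, lt_top_iff_ne_top]
  simp only [ENNReal.toReal_ofNat, Real.rpow_ofNat, enorm_eq_nnnorm, ← ENNReal.coe_pow,
    ENNReal.tsum_coe_ne_top_iff_summable]
  rw [← NNReal.summable_coe]
  simp

variable (H₁ H₂) in
/-- The Hilbert–Schmidt operators, as a subspace of the bounded operators. -/
def hsSubmodule : Submodule ℂ (H₁ →L[ℂ] H₂) where
  carrier := {X | IsHS X}
  add_mem' := fun {X Y} hX hY => by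
    simp only [Set.mem_ofPred_eq, isHS_iff_memℓp] at *
    exact hX.add hY
  zero_mem' := by
    simp only [Set.mem_ofPred_eq, isHS_iff_memℓp]
    exact zero_memℓp
  smul_mem' := fun a X hX => by
    simp only [Set.mem_ofPred_eq, isHS_iff_memℓp] at *
    exact hX.const_smul a

variable (H₁ H₂) in
/-- The Hilbert space `C₂(H₁, H₂)` of Hilbert–Schmidt operators, with the inner product
`⟪X, Y⟫ = Tr (X* Y) = ∑ ⟪X e_i, Y e_i⟫`. -/
def HS : Type _ := hsSubmodule H₁ H₂

instance : AddCommGroup (HS H₁ H₂) := inferInstanceAs (AddCommGroup (hsSubmodule H₁ H₂))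

instance : Module ℂ (HS H₁ H₂) := inferInstanceAs (Module ℂ (hsSubmodule H₁ H₂))

/-- The operator underlying an element of `C₂(H₁, H₂)`. -/
def HS.op (X : HS H₁ H₂) : H₁ →L[ℂ] H₂ := X.1

theorem HS.isHS (X : HS H₁ H₂) : IsHS X.op := X.2

theorem HS.ext {X Y : HS H₁ H₂} (h : ∀ x, X.op x = Y.op x) : X = Y :=
  Subtype.ext (ContinuousLinearMap.ext h)

/-- The element of `C₂(H₁, H₂)` given by a Hilbert–Schmidt operator. -/
def HS.mk (X : H₁ →L[ℂ] H₂) (h : IsHS X) : HS H₁ H₂ := ⟨X, h⟩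

/-- Coordinates of a Hilbert–Schmidt operator: `X ↦ (X e_i)`. -/
def HS.coord : HS H₁ H₂ →ₗ[ℂ] lp (fun _ : basisIdx H₁ => H₂) 2 where
  toFun X := ⟨fun i => X.op (stdBasis H₁ i), (isHS_iff_memℓp X.op).1 X.isHS⟩
  map_add' _ _ := rfl
  map_smul' _ _ := rfl

theorem HS.sq_norm_coord (X : HS H₁ H₂) : ENNReal.ofReal (‖HS.coord X‖ ^ 2) = hsSq X.op := by
  have h := lp.norm_rpow_eq_tsum (p := 2) (by norm_num) (HS.coord X)
  have hs := (memℓp_gen_iff (by norm_num : 0 < (2 : ℝ≥0∞).toReal)).1 (HS.coord X).2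
  simp only [ENNReal.toReal_ofNat, Real.rpow_ofNat] at h hs
  rw [h, ENNReal.ofReal_tsum_of_nonneg (fun i => by positivity) hs, hsSq]
  refine tsum_congr fun i => ?_
  rw [ENNReal.ofReal_pow (norm_nonneg _), ofReal_norm]
  rfl

theorem HS.norm_op_apply_le_coord (X : HS H₁ H₂) (x : H₁) : ‖X.op x‖ ≤ ‖HS.coord X‖ * ‖x‖ := by
  have h := enorm_apply_sq_le X.op x
  rw [← HS.sq_norm_coord, ← ofReal_norm, ← ofReal_norm, ← ENNReal.ofReal_pow (norm_nonneg _),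
    ← ENNReal.ofReal_pow (norm_nonneg _), ← ENNReal.ofReal_mul (by positivity),
    ENNReal.ofReal_le_ofReal_iff (by positivity), ← mul_pow] at h
  exact le_of_sq_le_sq h (by positivity)

theorem HS.coord_injective : Function.Injective (HS.coord : HS H₁ H₂ →ₗ[ℂ] _) := by
  rw [injective_iff_map_eq_zero]
  intro X hX
  refine HS.ext fun x => ?_
  have h := HS.norm_op_apply_le_coord X x
  rw [hX, norm_zero, zero_mul] at h
  exact norm_le_zero_iff.1 h

instance : NormedAddCommGroup (HS H₁ H₂) :=
  NormedAddCommGroup.induced _ _ HS.coord HS.coord_injective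

instance : InnerProductSpace ℂ (HS H₁ H₂) where
  norm_smul_le a X := by
    change ‖HS.coord (a • X)‖ ≤ ‖a‖ * ‖HS.coord X‖
    rw [map_smul, norm_smul]
  inner X Y := ⟪HS.coord X, HS.coord Y⟫_ℂ
  norm_sq_eq_re_inner X := norm_sq_eq_re_inner (𝕜 := ℂ) (HS.coord X)
  conj_inner_symm X Y := inner_conj_symm (HS.coord X) (HS.coord Y)
  add_left X Y Z := by
    change ⟪HS.coord (X + Y), HS.coord Z⟫_ℂ = _
    rw [map_add, inner_add_left]
  smul_left X Y a := by
    change ⟪HS.coord (a • X), HS.coord Y⟫_ℂ = _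
    rw [map_smul, inner_smul_left]

theorem HS.inner_eq_tsum (X Y : HS H₁ H₂) :
    ⟪X, Y⟫_ℂ = ∑' i, ⟪X.op (stdBasis H₁ i), Y.op (stdBasis H₁ i)⟫_ℂ :=
  lp.inner_eq_tsum (HS.coord X) (HS.coord Y)

theorem HS.sq_norm (X : HS H₁ H₂) : ENNReal.ofReal (‖X‖ ^ 2) = hsSq X.op := HS.sq_norm_coord X

theorem HS.norm_op_apply_le (X : HS H₁ H₂) (x : H₁) : ‖X.op x‖ ≤ ‖X‖ * ‖x‖ :=
  HS.norm_op_apply_le_coord X x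

/-- `X ↦ X` from the Hilbert–Schmidt operators to the bounded operators is continuous. -/
def HS.opL : HS H₁ H₂ →L[ℂ] H₁ →L[ℂ] H₂ :=
  LinearMap.mkContinuous (hsSubmodule H₁ H₂).subtype 1 fun X => by
    rw [one_mul]
    exact ContinuousLinearMap.opNorm_le_bound _ (norm_nonneg _) (HS.norm_op_apply_le X)

instance : CompleteSpace (HS H₁ H₂) := by
  refine Metric.complete_of_cauchySeq_tendsto fun u hu => ?_
  have hiso : Isometry (HS.coord : HS H₁ H₂ →ₗ[ℂ] lp (fun _ : basisIdx H₁ => H₂) 2) :=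
    AddMonoidHomClass.isometry_of_norm _ fun _ => rfl
  obtain ⟨v, hv⟩ := cauchySeq_tendsto_of_complete (hiso.uniformContinuous.comp_cauchySeq hu)
  obtain ⟨X, hX⟩ := cauchySeq_tendsto_of_complete
    ((HS.opL (H₁ := H₁) (H₂ := H₂)).uniformContinuous.comp_cauchySeq hu)
  have hXv : ∀ i, X (stdBasis H₁ i) = v i := by
    intro i
    have h1 : Filter.Tendsto (fun n => (u n).op (stdBasis H₁ i)) Filter.atTop
        (nhds (X (stdBasis H₁ i))) :=
      ((ContinuousLinearMap.apply ℂ H₂ (stdBasis H₁ i)).continuous.tendsto X).comp hX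
    have h2 : Filter.Tendsto (fun n => (u n).op (stdBasis H₁ i)) Filter.atTop (nhds (v i)) := by
      rw [tendsto_iff_norm_sub_tendsto_zero] at hv ⊢
      refine squeeze_zero (fun _ => norm_nonneg _) (fun n => ?_) hv
      exact lp.norm_apply_le_norm (by norm_num) (HS.coord (u n) - v) i
    exact tendsto_nhds_unique h1 h2
  have hXHS : IsHS X := by
    rw [isHS_iff_memℓp]
    have : (fun i => X (stdBasis H₁ i)) = (v : ∀ i, H₂) := funext hXv
    rw [this]
    exact v.2
  refine ⟨HS.mk X hXHS, ?_⟩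
  have hc : HS.coord (HS.mk X hXHS) = v := Subtype.ext (funext hXv)
  rw [hiso.isUniformInducing.isInducing.tendsto_nhds_iff, hc]
  exact hv

end HilbertSchmidt

/-! ### The diagonal representation -/

section Diagonal

variable {G : Type*} [Group G]
  {H₁ : Type*} [NormedAddCommGroup H₁] [InnerProductSpace ℂ H₁] [CompleteSpace H₁]
  {H₂ : Type*} [NormedAddCommGroup H₂] [InnerProductSpace ℂ H₂] [CompleteSpace H₂]
  {c : G → G → Circle}

theorem isHS_conjOp (π₁ : ProjRep G H₁ c) (π₂ : ProjRep G H₂ c) (g : G) (X : H₁ →L[ℂ] H₂) :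
    hsSq (conjOp π₁ π₂ g X) = hsSq X :=
  hsSq_conj _ _ _

/-- The diagonal (adjoint) representation `X ↦ π₂(g) X π₁(g)⁻¹` of `G` on `C₂(H₁, H₂)`. It is a
unitary representation, as `π₁` and `π₂` have the same multiplier. -/
def diagonal (π₁ : ProjRep G H₁ c) (π₂ : ProjRep G H₂ c) :
    ProjRep G (HS H₁ H₂) (fun _ _ => 1) where
  toFun g :=
    { toFun := fun X => HS.mk (conjOp π₁ π₂ g X.op) (by
        rw [IsHS, isHS_conjOp]; exact X.isHS)
      invFun := fun X => HS.mk ((π₂.toFun g).symm.toContinuousLinearEquiv.toContinuousLinearMap ∘L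
        X.op ∘L (π₁.toFun g).toContinuousLinearEquiv.toContinuousLinearMap) (by
        rw [IsHS, hsSq_conj]; exact X.isHS)
      map_add' := fun X Y => HS.ext fun x => (π₂.toFun g).map_add _ _
      map_smul' := fun a X => HS.ext fun x => (π₂.toFun g).map_smul a _
      left_inv := fun X => HS.ext fun x => by simp [HS.op, HS.mk, conjOp]
      right_inv := fun X => HS.ext fun x => by simp [HS.op, HS.mk, conjOp]
      norm_map' := fun X => by
        have h : ENNReal.ofReal (‖HS.mk (conjOp π₁ π₂ g X.op) (by
            rw [IsHS, isHS_conjOp]; exact X.isHS)‖ ^ 2) = ENNReal.ofReal (‖X‖ ^ 2) := by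
          rw [HS.sq_norm, HS.sq_norm]
          exact isHS_conjOp _ _ _ _
        rw [ENNReal.ofReal_eq_ofReal_iff (by positivity) (by positivity)] at h
        exact (pow_left_inj₀ (norm_nonneg _) (norm_nonneg _) two_ne_zero).1 h }
  mul_apply g h X := by
    refine HS.ext fun x => ?_
    have key : (π₁.toFun h).symm ((π₁.toFun g).symm x) =
        (starRingEnd ℂ (c g h : ℂ)) • (π₁.toFun (g * h)).symm x := by
      rw [LinearIsometryEquiv.symm_apply_eq, LinearIsometryEquiv.symm_apply_eq, map_smul,
        map_smul, π₁.mul_apply, LinearIsometryEquiv.apply_symm_apply, smul_smul,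
        ← Circle.coe_inv_eq_conj, ← Circle.coe_mul, inv_mul_cancel, Circle.coe_one, one_smul]
    change π₂.toFun g (π₂.toFun h (X.op ((π₁.toFun h).symm ((π₁.toFun g).symm x)))) =
      ((1 : Circle) : ℂ) • π₂.toFun (g * h) (X.op ((π₁.toFun (g * h)).symm x))
    rw [key, π₂.mul_apply, map_smul, map_smul, smul_smul,
      ← Circle.coe_inv_eq_conj, ← Circle.coe_mul, mul_inv_cancel]

variable (H₂) in
/-- The `Γ`-wandering subspace `{Y ∈ C₂(H₁, H₂) : Y = Y P_L} ≅ C₂(L, H₂)` of `C₂(H₁, H₂)`. It is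
identified with the `L²`-space of intertwiners, `X` corresponding to `X P_L`. -/
def rightSupported (L : Submodule ℂ H₁) : Submodule ℂ (HS H₁ H₂) where
  carrier := {Y | ∀ x ∈ Lᗮ, Y.op x = 0}
  add_mem' := fun {X Y} hX hY x hx => by
    change X.op x + Y.op x = 0
    rw [hX x hx, hY x hx, add_zero]
  zero_mem' := fun x _ => rfl
  smul_mem' := fun a X hX x hx => by
    change a • X.op x = 0
    rw [hX x hx, smul_zero]

instance (L : Submodule ℂ H₁) : CompleteSpace (rightSupported H₂ L) := by
  apply IsClosed.completeSpace_coe (hs := ?_)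
  have : (rightSupported H₂ L : Set (HS H₁ H₂)) =
      ⋂ x ∈ Lᗮ, {Y | (HS.opL Y) x = 0} := by
    ext Y
    simp only [Set.mem_iInter]
    exact Iff.rfl
  rw [this]
  refine isClosed_biInter fun x _ => isClosed_eq ?_ continuous_const
  exact (HS.opL (H₁ := H₁) (H₂ := H₂)).continuous.clm_apply continuous_const

/-- `X P_L`, as a vector of the wandering subspace, for `X` with `X P_L` Hilbert–Schmidt. -/
def toRight (L : Submodule ℂ H₁) [L.HasOrthogonalProjection] (X : H₁ →L[ℂ] H₂)
    (h : IsHS (X ∘L L.starProjection)) : rightSupported H₂ L :=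
  ⟨HS.mk (X ∘L L.starProjection) h, fun x hx => by
    change X (L.starProjection x) = 0
    rw [(L.starProjection_apply_eq_zero_iff).2 hx, map_zero]⟩

/-- The trace `τ_{R(Γ)} ⊗ Tr` of a positive element `A` of `π(Γ)' ≅ R(Γ) ⊗ B(L)`, that is
`Tr (P_L A P_L)`, the trace of the coefficient of `A` at the identity of `Γ`. -/
def trace (L : Submodule ℂ H₁) [CompleteSpace L] (A : H₁ →L[ℂ] H₁) : ℝ≥0∞ :=
  ∑' i, ENNReal.ofReal (RCLike.re ⟪(stdBasis L i : H₁), A (stdBasis L i)⟫_ℂ)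

end Diagonal

end HeckeRep

end

open HeckeRep

/-!
The whole theorem rests on the identification of `ℓ²(G) ⊗ L` with `ℓ²(G/Γ) ⊗ H` sending
`δ_g ⊗ l` to `δ_{gΓ} ⊗ π(g) l` (`IsWandering.cosetEquiv`): on the fibre of the coset `gΓ` it is the
decomposition of `H` by the wandering subspace `L`, moved by `π(g)`. The multiplier `c` disappears in
this picture, since the phase in the matrix entries of a convolutor turns `π(k⁻¹h)` into
`π(k)⁻¹ π(h)`. The series `S(ΓσΓ)` becomes `M ⊗ 1`, where `M` is the adjacency matrix of the relation
`q⁻¹q' ⊆ ΓσΓ` on `G/Γ`; its rows and columns are finite of constant size by almost normality, so it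
is bounded by Schur's test, and its adjoint is the matrix of `Γσ⁻¹Γ`. An intertwiner `X`, as a
convolutor on `ℓ²(G)`, becomes the block diagonal operator with blocks `π₂(t) X π₁(t)⁻¹`, `tΓ ∈ G/Γ`.
The conditional expectation picks the entry at the trivial coset, which for the product of the Hecke
matrix, the block diagonal operator and the adjoint Hecke matrix is the sum of the blocks over the
cosets in `ΓσΓ` (`transport_hecke`).

For the `L²`-theory, the vectors `π₁(γ) eᵢ`, with `(eᵢ)` a Hilbert basis of `L₁`, form a Hilbert basis
of `H₁` in which `{Y : Y = Y P_{L₁}}` is visibly wandering and generating, with projection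
`Y ↦ Y P_{L₁}`, and in which both traces are computed. The Hecke operator is bounded in
Hilbert–Schmidt norm because Parseval's identity holds along each left coset of `Γ` and `(tΓ)⁻¹` is
covered by finitely many left cosets (`IsWandering.tsum_enorm_sq_coset_le`,
`hsSq_conjOp_comp_starProjection_le`). The same estimate gives the convergence of
`∑ P_L π(θ) X P_{L₁}` along a coset, for `X P_{L₁}` of finite rank (`hasSum_coset`). As the diagonal
representation is unitary, the sums for `σ` and `σ⁻¹` are adjoint to each other; hence so are the
bounded Hecke operators (`heckeL2_adjoint`), which gives the weak convergence at every vector.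
-/

namespace HeckeRep

/-! ### Cosets in a double coset -/

section Cosets

variable {G : Type*} [Group G] {Γ : Subgroup G} {σ g γ : G}

theorem mul_mem_doubleCoset_left (hγ : γ ∈ Γ) :
    γ * g ∈ DoubleCoset.doubleCoset σ (Γ : Set G) Γ ↔
      g ∈ DoubleCoset.doubleCoset σ (Γ : Set G) Γ := by
  simp only [DoubleCoset.mem_doubleCoset, SetLike.mem_coe]
  constructor
  · rintro ⟨x, hx, y, hy, h⟩
    exact ⟨γ⁻¹ * x, Γ.mul_mem (Γ.inv_mem hγ) hx, y, hy, by
      rw [mul_assoc, mul_assoc, ← mul_assoc x, ← h, inv_mul_cancel_left]⟩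
  · rintro ⟨x, hx, y, hy, h⟩
    exact ⟨γ * x, Γ.mul_mem hγ hx, y, hy, by rw [h]; group⟩

theorem mul_mem_doubleCoset_right (hγ : γ ∈ Γ) :
    g * γ ∈ DoubleCoset.doubleCoset σ (Γ : Set G) Γ ↔
      g ∈ DoubleCoset.doubleCoset σ (Γ : Set G) Γ := by
  simp only [DoubleCoset.mem_doubleCoset, SetLike.mem_coe]
  constructor
  · rintro ⟨x, hx, y, hy, h⟩
    exact ⟨x, hx, y * γ⁻¹, Γ.mul_mem hy (Γ.inv_mem hγ), by
      rw [← mul_assoc, ← h, mul_inv_cancel_right]⟩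
  · rintro ⟨x, hx, y, hy, h⟩
    exact ⟨x, hx, y * γ, Γ.mul_mem hy hγ, by rw [h]; group⟩

theorem inv_mem_doubleCoset_inv :
    g⁻¹ ∈ DoubleCoset.doubleCoset σ⁻¹ (Γ : Set G) Γ ↔
      g ∈ DoubleCoset.doubleCoset σ (Γ : Set G) Γ := by
  simp only [DoubleCoset.mem_doubleCoset, SetLike.mem_coe]
  constructor
  · rintro ⟨x, hx, y, hy, h⟩
    exact ⟨y⁻¹, Γ.inv_mem hy, x⁻¹, Γ.inv_mem hx, by rw [← inv_inv g, h]; group⟩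
  · rintro ⟨x, hx, y, hy, h⟩
    exact ⟨y⁻¹, Γ.inv_mem hy, x⁻¹, Γ.inv_mem hx, by rw [h]; group⟩

variable (Γ σ) in
/-- The left cosets of `Γ` contained in the double coset `ΓσΓ`. -/
def heckeCosets : Set (G ⧸ Γ) := {q | q.out ∈ DoubleCoset.doubleCoset σ (Γ : Set G) Γ}

theorem mk_mem_heckeCosets :
    (g : G ⧸ Γ) ∈ heckeCosets Γ σ ↔ g ∈ DoubleCoset.doubleCoset σ (Γ : Set G) Γ := by
  obtain ⟨h, hh⟩ := QuotientGroup.mk_out_eq_mul Γ g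
  change (g : G ⧸ Γ).out ∈ DoubleCoset.doubleCoset σ (Γ : Set G) Γ ↔ _
  rw [hh, mul_mem_doubleCoset_right h.2]

/-- The cosets `γσΓ` depend only on the class of `γ` modulo `Γ ∩ σΓσ⁻¹`, which has finite index
in `Γ`. -/
theorem IsAlmostNormal.finite_heckeCosets (hΓ : IsAlmostNormal Γ) (σ : G) :
    (heckeCosets Γ σ).Finite := by
  have hfin : ((Γ.map (MulAut.conj σ).toMonoidHom).subgroupOf Γ).FiniteIndex := ⟨hΓ σ⟩
  have : Finite (Γ ⧸ (Γ.map (MulAut.conj σ).toMonoidHom).subgroupOf Γ) := inferInstance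
  refine (Set.finite_range fun k : Γ ⧸ (Γ.map (MulAut.conj σ).toMonoidHom).subgroupOf Γ =>
    (((k.out : G) * σ : G) : G ⧸ Γ)).subset ?_
  intro q hq
  obtain ⟨x, hx, y, hy, h⟩ := DoubleCoset.mem_doubleCoset.1 hq
  refine ⟨QuotientGroup.mk ⟨x, hx⟩, ?_⟩
  obtain ⟨k, hk⟩ := QuotientGroup.mk_out_eq_mul
    ((Γ.map (MulAut.conj σ).toMonoidHom).subgroupOf Γ) ⟨x, hx⟩
  obtain ⟨z, hz, hzk⟩ := Subgroup.mem_map.1 (Subgroup.mem_subgroupOf.1 k.2)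
  have hzk' : σ * z * σ⁻¹ = (k : Γ) := by simpa using hzk
  simp only [hk]
  rw [← QuotientGroup.out_eq' q, h]
  refine QuotientGroup.eq.2 ?_
  have e : (((⟨x, hx⟩ * (k : Γ) : Γ) : G) * σ)⁻¹ * (x * σ * y) = z⁻¹ * y := by
    rw [Subgroup.coe_mul, ← hzk']
    group
  rw [e]
  exact Γ.mul_mem (Γ.inv_mem hz) hy

/-- The disjoint unions `ΓσΓ = ⋃ sᵢσΓ` are the enumerations of the cosets in `ΓσΓ` by
representatives `sᵢσ`. -/
theorem isCosetDecomposition_iff {ι : Type*} {s : ι → G} (hs : ∀ i, s i ∈ Γ) :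
    IsCosetDecomposition Γ σ s ↔
      Set.BijOn (fun i => ((s i * σ : G) : G ⧸ Γ)) Set.univ (heckeCosets Γ σ) := by
  have hmem : ∀ i g, g ∈ (s i * σ) • (Γ : Set G) ↔ ((s i * σ : G) : G ⧸ Γ) = g := by
    intro i g
    rw [Set.mem_smul_set_iff_inv_smul_mem, QuotientGroup.eq, smul_eq_mul, SetLike.mem_coe]
  constructor
  · intro h
    refine ⟨fun i _ => mk_mem_heckeCosets.2 (DoubleCoset.mem_doubleCoset.2
      ⟨s i, hs i, 1, Γ.one_mem, by simp⟩), fun i _ j _ hij => ?_, fun q hq => ?_⟩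
    · by_contra hne
      exact Set.disjoint_left.1 (h.disjoint hne) ((hmem i (s j * σ)).2 hij)
        ((hmem j (s j * σ)).2 rfl)
    · have : q.out ∈ DoubleCoset.doubleCoset σ (Γ : Set G) Γ := hq
      rw [h.union, Set.mem_iUnion] at this
      obtain ⟨i, hi⟩ := this
      exact ⟨i, trivial, by rw [← QuotientGroup.out_eq' q]; exact (hmem i _).1 hi⟩
  · intro h
    refine ⟨hs, ?_, fun i j hij => Set.disjoint_left.2 fun g hi hj => hij ?_⟩
    · ext g
      rw [← mk_mem_heckeCosets, ← h.image_eq, Set.mem_iUnion]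
      simp [hmem]
    · exact h.injOn trivial trivial (((hmem i g).1 hi).trans ((hmem j g).1 hj).symm)

theorem IsAlmostNormal.exists_isCosetDecomposition (hΓ : IsAlmostNormal Γ) (σ : G) :
    ∃ (n : ℕ) (s : Fin n → G), IsCosetDecomposition Γ σ s := by
  have hfin := hΓ.finite_heckeCosets σ
  have : Finite (heckeCosets Γ σ) := hfin
  obtain ⟨n, ⟨e⟩⟩ := Finite.exists_equiv_fin (heckeCosets Γ σ)
  have key : ∀ q : heckeCosets Γ σ, ∃ x ∈ Γ, ((x * σ : G) : G ⧸ Γ) = q := by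
    rintro ⟨q, hq⟩
    obtain ⟨x, hx, y, hy, h⟩ := DoubleCoset.mem_doubleCoset.1 hq
    refine ⟨x, hx, ?_⟩
    change _ = q
    rw [← QuotientGroup.out_eq' q, h]
    exact QuotientGroup.eq.2 (by simpa [mul_assoc] using hy)
  choose x hx hxq using key
  refine ⟨n, fun i => x (e.symm i), (isCosetDecomposition_iff fun i => hx _).2 ?_⟩
  simp only [hxq]
  refine ⟨fun i _ => (e.symm i).2, fun i _ j _ hij => e.symm.injective (Subtype.ext hij),
    fun q hq => ⟨e ⟨q, hq⟩, trivial, by simp⟩⟩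

end Cosets

/-! ### Projective representations -/

section Representations

variable {G : Type*} [Group G] {Γ : Subgroup G}
  {H : Type*} [NormedAddCommGroup H] [InnerProductSpace ℂ H]
  {H₁ : Type*} [NormedAddCommGroup H₁] [InnerProductSpace ℂ H₁]
  {H₂ : Type*} [NormedAddCommGroup H₂] [InnerProductSpace ℂ H₂]
  {c : G → G → Circle}

/-- The phase `conj (c (k, k⁻¹h))` in the matrix entries of a convolutor is the one that turns
`π(k⁻¹h)` into `π(k)⁻¹ π(h)`. -/
theorem ProjRep.symm_apply (π : ProjRep G H c) (k h : G) (x : H) :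
    (π.toFun k).symm (π.toFun h x) =
      (starRingEnd ℂ (c k (k⁻¹ * h) : ℂ)) • π.toFun (k⁻¹ * h) x := by
  rw [LinearIsometryEquiv.symm_apply_eq, map_smul, π.mul_apply, mul_inv_cancel_left, smul_smul,
    ← Circle.coe_inv_eq_conj, ← Circle.coe_mul, inv_mul_cancel, Circle.coe_one, one_smul]

theorem ProjRep.mul_apply_of_mem (π : ProjRep G H c) (hc : ∀ γ ∈ Γ, ∀ γ' ∈ Γ, c γ γ' = 1)
    {γ γ' : G} (hγ : γ ∈ Γ) (hγ' : γ' ∈ Γ) (x : H) :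
    π.toFun γ (π.toFun γ' x) = π.toFun (γ * γ') x := by
  rw [π.mul_apply, hc γ hγ γ' hγ', Circle.coe_one, one_smul]

theorem ProjRep.map_one_apply (π : ProjRep G H c) (hc : c 1 1 = 1) (x : H) :
    π.toFun 1 x = x := by
  apply (π.toFun 1).injective
  rw [π.mul_apply, hc, one_mul, Circle.coe_one, one_smul]

theorem ProjRep.symm_eq_inv (π : ProjRep G H c) (hc : ∀ γ ∈ Γ, ∀ γ' ∈ Γ, c γ γ' = 1)
    {γ : G} (hγ : γ ∈ Γ) (x : H) : (π.toFun γ).symm x = π.toFun γ⁻¹ x := by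
  rw [LinearIsometryEquiv.symm_apply_eq, π.mul_apply_of_mem hc hγ (Γ.inv_mem hγ), mul_inv_cancel,
    π.map_one_apply (hc 1 Γ.one_mem 1 Γ.one_mem)]

theorem ProjRep.exists_symm_mul (π : ProjRep G H c) (g h : G) :
    ∃ z : ℂ, ‖z‖ = 1 ∧
      ∀ x, (π.toFun (g * h)).symm x = z • (π.toFun h).symm ((π.toFun g).symm x) := by
  refine ⟨c g h, Circle.norm_coe _, fun x => ?_⟩
  rw [LinearIsometryEquiv.symm_apply_eq, map_smul, ← π.mul_apply,
    LinearIsometryEquiv.apply_symm_apply, LinearIsometryEquiv.apply_symm_apply]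

theorem ProjRep.norm_clm_symm_mul (π : ProjRep G H c) {F : Type*} [NormedAddCommGroup F]
    [NormedSpace ℂ F] (T : H →L[ℂ] F) (g h : G) (x : H) :
    ‖T ((π.toFun (g * h)).symm x)‖ = ‖T ((π.toFun h).symm ((π.toFun g).symm x))‖ := by
  obtain ⟨z, hz, h⟩ := π.exists_symm_mul g h
  rw [h, map_smul, norm_smul, hz, one_mul]

theorem ProjRep.norm_clm_symm_inv (π : ProjRep G H c) {F : Type*} [NormedAddCommGroup F]
    [NormedSpace ℂ F] (T : H →L[ℂ] F) (g : G) (x : H) :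
    ‖T ((π.toFun g⁻¹).symm x)‖ = ‖T (π.toFun g x)‖ := by
  obtain ⟨y, rfl⟩ := (π.toFun g⁻¹).surjective x
  rw [LinearIsometryEquiv.symm_apply_apply, π.mul_apply, mul_inv_cancel, map_smul, norm_smul,
    Circle.norm_coe, one_mul]
  -- no normalization of `c` is assumed here, so `π 1` is only known to be a phase
  obtain ⟨y, rfl⟩ := (π.toFun 1).surjective y
  rw [π.mul_apply, one_mul, map_smul, norm_smul, Circle.norm_coe, one_mul]

theorem conjOp_apply (π₁ : ProjRep G H₁ c) (π₂ : ProjRep G H₂ c) (g : G) (X : H₁ →L[ℂ] H₂)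
    (x : H₁) : conjOp π₁ π₂ g X x = π₂.toFun g (X ((π₁.toFun g).symm x)) := rfl

/-- The phases of `π₁` and `π₂` cancel, so that conjugation is an honest action of `G`. -/
theorem conjOp_conjOp (π₁ : ProjRep G H₁ c) (π₂ : ProjRep G H₂ c) (g h : G) (X : H₁ →L[ℂ] H₂) :
    conjOp π₁ π₂ g (conjOp π₁ π₂ h X) = conjOp π₁ π₂ (g * h) X := by
  ext x
  have key : (π₁.toFun h).symm ((π₁.toFun g).symm x) =
      (starRingEnd ℂ (c g h : ℂ)) • (π₁.toFun (g * h)).symm x := by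
    rw [LinearIsometryEquiv.symm_apply_eq, LinearIsometryEquiv.symm_apply_eq, map_smul,
      map_smul, π₁.mul_apply, LinearIsometryEquiv.apply_symm_apply, smul_smul,
      ← Circle.coe_inv_eq_conj, ← Circle.coe_mul, inv_mul_cancel, Circle.coe_one, one_smul]
  simp only [conjOp_apply]
  rw [key, π₂.mul_apply, map_smul, map_smul, smul_smul,
    ← Circle.coe_inv_eq_conj, ← Circle.coe_mul, mul_inv_cancel, Circle.coe_one, one_smul]

theorem mem_intertwiners_iff_conjOp {π₁ : ProjRep G H₁ c} {π₂ : ProjRep G H₂ c}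
    {X : H₁ →L[ℂ] H₂} :
    X ∈ intertwiners π₁ π₂ Γ ↔ ∀ γ ∈ Γ, conjOp π₁ π₂ γ X = X := by
  constructor
  · intro hX γ hγ
    ext x
    rw [conjOp_apply, ← hX γ hγ, LinearIsometryEquiv.apply_symm_apply]
  · intro hX γ hγ x
    conv_lhs => rw [← hX γ hγ, conjOp_apply, LinearIsometryEquiv.symm_apply_apply]

/-- For an intertwiner `X`, the operator `π₂(t) X π₁(t)⁻¹` depends only on the coset `tΓ`. -/
theorem conjOp_congr_coset {π₁ : ProjRep G H₁ c} {π₂ : ProjRep G H₂ c} {X : H₁ →L[ℂ] H₂}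
    (hX : X ∈ intertwiners π₁ π₂ Γ) {g h : G} (hgh : (g : G ⧸ Γ) = h) :
    conjOp π₁ π₂ g X = conjOp π₁ π₂ h X := by
  have hm : g⁻¹ * h ∈ Γ := QuotientGroup.eq.1 hgh
  rw [← mul_inv_cancel_left g h, ← conjOp_conjOp, mem_intertwiners_iff_conjOp.1 hX _ hm]

theorem conjOp_out {π₁ : ProjRep G H₁ c} {π₂ : ProjRep G H₂ c} {X : H₁ →L[ℂ] H₂}
    (hX : X ∈ intertwiners π₁ π₂ Γ) (g : G) :
    conjOp π₁ π₂ (g : G ⧸ Γ).out X = conjOp π₁ π₂ g X :=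
  conjOp_congr_coset hX (QuotientGroup.out_eq' _)

theorem conjOp_add (π₁ : ProjRep G H₁ c) (π₂ : ProjRep G H₂ c) (g : G) (X Y : H₁ →L[ℂ] H₂) :
    conjOp π₁ π₂ g (X + Y) = conjOp π₁ π₂ g X + conjOp π₁ π₂ g Y := by
  ext x; simp [conjOp_apply]

theorem conjOp_smul (π₁ : ProjRep G H₁ c) (π₂ : ProjRep G H₂ c) (g : G) (a : ℂ)
    (X : H₁ →L[ℂ] H₂) : conjOp π₁ π₂ g (a • X) = a • conjOp π₁ π₂ g X := by
  ext x; simp [conjOp_apply]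

theorem norm_conjOp_le (π₁ : ProjRep G H₁ c) (π₂ : ProjRep G H₂ c) (g : G) (X : H₁ →L[ℂ] H₂) :
    ‖conjOp π₁ π₂ g X‖ ≤ ‖X‖ := by
  refine ContinuousLinearMap.opNorm_le_bound _ (norm_nonneg _) fun x => ?_
  rw [conjOp_apply, LinearIsometryEquiv.norm_map]
  refine (X.le_opNorm _).trans_eq ?_
  rw [LinearIsometryEquiv.norm_map]

/-! ### The Hecke operator on intertwiners -/

theorem hecke_eq_sum (hΓ : IsAlmostNormal Γ) (π₁ : ProjRep G H₁ c) (π₂ : ProjRep G H₂ c) (σ : G)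
    (X : H₁ →L[ℂ] H₂) :
    hecke π₁ π₂ Γ σ X = ∑ q ∈ (hΓ.finite_heckeCosets σ).toFinset, conjOp π₁ π₂ q.out X :=
  finsum_mem_eq_finite_toFinset_sum _ (hΓ.finite_heckeCosets σ)

theorem hecke_eq_sum_of_isCosetDecomposition (hΓ : IsAlmostNormal Γ) {π₁ : ProjRep G H₁ c}
    {π₂ : ProjRep G H₂ c} {σ : G} {X : H₁ →L[ℂ] H₂} (hX : X ∈ intertwiners π₁ π₂ Γ) {n : ℕ}
    {s : Fin n → G} (hs : IsCosetDecomposition Γ σ s) :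
    hecke π₁ π₂ Γ σ X = ∑ i, conjOp π₁ π₂ (s i * σ) X := by
  have hb := (isCosetDecomposition_iff hs.mem).1 hs
  rw [hecke_eq_sum hΓ]
  symm
  refine Finset.sum_bij (fun i _ => ((s i * σ : G) : G ⧸ Γ)) ?_ ?_ ?_ ?_
  · intro i _
    exact (Set.Finite.mem_toFinset _).2 (hb.mapsTo (Set.mem_univ i))
  · intro i _ j _ hij
    exact hb.injOn trivial trivial hij
  · intro q hq
    obtain ⟨i, -, hi⟩ := hb.surjOn ((Set.Finite.mem_toFinset _).1 hq)
    exact ⟨i, Finset.mem_univ _, hi⟩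
  · intro i _
    exact (conjOp_out hX _).symm

/-- Left translation by `γ ∈ Γ` permutes the cosets in `ΓσΓ`, so conjugation by `γ` permutes the
terms of the Hecke operator. -/
theorem hecke_mem_intertwiners (hΓ : IsAlmostNormal Γ) {π₁ : ProjRep G H₁ c}
    {π₂ : ProjRep G H₂ c} (σ : G) {X : H₁ →L[ℂ] H₂} (hX : X ∈ intertwiners π₁ π₂ Γ) :
    hecke π₁ π₂ Γ σ X ∈ intertwiners π₁ π₂ Γ := by
  refine mem_intertwiners_iff_conjOp.2 fun γ hγ => ?_
  have hmem : ∀ (q : G ⧸ Γ) (γ : G), γ ∈ Γ → q ∈ heckeCosets Γ σ → γ • q ∈ heckeCosets Γ σ := by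
    intro q γ hγ hq
    obtain ⟨g, rfl⟩ := QuotientGroup.mk_surjective q
    exact mk_mem_heckeCosets.2 ((mul_mem_doubleCoset_left hγ).2 (mk_mem_heckeCosets.1 hq))
  have hsum : conjOp π₁ π₂ γ (hecke π₁ π₂ Γ σ X) =
      ∑ q ∈ (hΓ.finite_heckeCosets σ).toFinset, conjOp π₁ π₂ (γ * q.out) X := by
    rw [hecke_eq_sum hΓ]
    simp_rw [← conjOp_conjOp]
    ext x
    simp [conjOp_apply]
  rw [hsum, hecke_eq_sum hΓ]
  refine Finset.sum_bij (fun q _ => γ • q) ?_ ?_ ?_ ?_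
  · intro q hq
    rw [Set.Finite.mem_toFinset] at hq ⊢
    exact hmem q γ hγ hq
  · intro q _ q' _ h
    exact smul_left_cancel γ h
  · intro q hq
    rw [Set.Finite.mem_toFinset] at hq
    exact ⟨γ⁻¹ • q, (Set.Finite.mem_toFinset _).2 (hmem q _ (Γ.inv_mem hγ) hq), smul_inv_smul γ q⟩
  · intro q _
    refine conjOp_congr_coset hX ?_
    rw [QuotientGroup.out_eq']
    conv_rhs => rw [← QuotientGroup.out_eq' q]
    rfl

end Representations

/-! ### Square-summable families -/

section SquareSummable

theorem enorm_sq_eq_ofReal {E : Type*} [NormedAddCommGroup E] (y : E) :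
    ‖y‖ₑ ^ 2 = ENNReal.ofReal (‖y‖ ^ 2) := by
  rw [ENNReal.ofReal_pow (norm_nonneg _), ofReal_norm]

variable {ι : Type*} {E : ι → Type*} [∀ i, NormedAddCommGroup (E i)]

theorem memℓp_two_iff_enorm {f : ∀ i, E i} : Memℓp f 2 ↔ ∑' i, ‖f i‖ₑ ^ 2 ≠ ⊤ := by
  rw [memℓp_gen_iff (by norm_num)]
  simp only [ENNReal.toReal_ofNat, Real.rpow_ofNat, enorm_eq_nnnorm, ← ENNReal.coe_pow,
    ENNReal.tsum_coe_ne_top_iff_summable]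
  rw [← NNReal.summable_coe]
  simp

theorem enorm_sq_lp_two (f : lp E 2) : ‖f‖ₑ ^ 2 = ∑' i, ‖f i‖ₑ ^ 2 := by
  have h := lp.norm_rpow_eq_tsum (p := 2) (by norm_num) f
  have hs := (memℓp_gen_iff (by norm_num : 0 < (2 : ℝ≥0∞).toReal)).1 f.2
  simp only [ENNReal.toReal_ofNat, Real.rpow_ofNat] at h hs
  rw [enorm_sq_eq_ofReal, h, ENNReal.ofReal_tsum_of_nonneg (fun i => by positivity) hs]
  exact tsum_congr fun i => (enorm_sq_eq_ofReal _).symm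

/-- `lp.inner_single_left` for constant families, in a form that `rw` can use. -/
theorem inner_single_lp {ι H : Type*} [NormedAddCommGroup H] [InnerProductSpace ℂ H]
    [DecidableEq ι] (i : ι) (x : H) (f : lp (fun _ : ι => H) 2) :
    ⟪(lp.single 2 i x : lp (fun _ : ι => H) 2), f⟫_ℂ = ⟪x, f i⟫_ℂ :=
  lp.inner_single_left i x f

end SquareSummable

/-! ### Row- and column-finite matrices of zeros and ones -/

section RelationMatrix

variable {Q : Type*} {H : Type*} [NormedAddCommGroup H]

theorem enorm_sum_sq_le {ι : Type*} (s : Finset ι) (f : ι → H) :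
    ‖∑ i ∈ s, f i‖ₑ ^ 2 ≤ s.card * ∑ i ∈ s, ‖f i‖ₑ ^ 2 := by
  have h : ‖∑ i ∈ s, f i‖ ^ 2 ≤ s.card * ∑ i ∈ s, ‖f i‖ ^ 2 :=
    (pow_le_pow_left₀ (norm_nonneg _) (norm_sum_le s f) 2).trans sq_sum_le_card_mul_sum_sq
  simp_rw [enorm_sq_eq_ofReal]
  rw [← ENNReal.ofReal_sum_of_nonneg (fun _ _ => by positivity), ← ENNReal.ofReal_natCast,
    ← ENNReal.ofReal_mul (by positivity)]
  exact ENNReal.ofReal_le_ofReal h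

/-- Schur's test for a matrix of zeros and ones: the row of `q` is `N q`, the column of `q` is
`N' q`. -/
theorem tsum_enorm_sum_sq_le {N N' : Q → Finset Q} (hNN' : ∀ q r, r ∈ N q ↔ q ∈ N' r) {d d' : ℕ}
    (hd : ∀ q, (N q).card ≤ d) (hd' : ∀ q, (N' q).card ≤ d') (f : Q → H) :
    ∑' q, ‖∑ r ∈ N q, f r‖ₑ ^ 2 ≤ (d * d' : ℕ) * ∑' q, ‖f q‖ₑ ^ 2 := by
  classical
  calc ∑' q, ‖∑ r ∈ N q, f r‖ₑ ^ 2
      ≤ ∑' q, d * ∑' r, if r ∈ N q then ‖f r‖ₑ ^ 2 else 0 := by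
        refine ENNReal.tsum_le_tsum fun q => (enorm_sum_sq_le _ _).trans ?_
        rw [tsum_eq_sum (s := N q) (fun r hr => if_neg hr),
          Finset.sum_congr rfl (fun r hr => if_pos hr)]
        gcongr
        exact hd q
    _ = d * ∑' r, ∑' q, if q ∈ N' r then ‖f r‖ₑ ^ 2 else 0 := by
        rw [ENNReal.tsum_mul_left, ENNReal.tsum_comm]
        simp_rw [hNN']
    _ ≤ d * ∑' r, d' * ‖f r‖ₑ ^ 2 := by
        gcongr with r
        rw [tsum_eq_sum (s := N' r) (fun q hq => if_neg hq),
          Finset.sum_congr rfl (fun q hq => if_pos hq), Finset.sum_const, nsmul_eq_mul]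
        gcongr
        exact hd' r
    _ = (d * d' : ℕ) * ∑' q, ‖f q‖ₑ ^ 2 := by
        rw [ENNReal.tsum_mul_left, Nat.cast_mul, mul_assoc]

variable [InnerProductSpace ℂ H]

/-- The bounded operator with a given row- and column-finite matrix of zeros and ones. -/
theorem exists_clm_relation {N N' : Q → Finset Q} (hNN' : ∀ q r, r ∈ N q ↔ q ∈ N' r) {d d' : ℕ}
    (hd : ∀ q, (N q).card ≤ d) (hd' : ∀ q, (N' q).card ≤ d') :
    ∃ M : lp (fun _ : Q => H) 2 →L[ℂ] lp (fun _ : Q => H) 2,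
      ∀ f q, M f q = ∑ r ∈ N q, f r := by
  have hbound := fun f : lp (fun _ : Q => H) 2 =>
    (tsum_enorm_sum_sq_le hNN' hd hd' f).trans_eq (by rw [← enorm_sq_lp_two])
  have hmem : ∀ f : lp (fun _ : Q => H) 2, Memℓp (fun q => ∑ r ∈ N q, f r) 2 := fun f =>
    memℓp_two_iff_enorm.2 (ne_top_of_le_ne_top
      (ENNReal.mul_ne_top (ENNReal.natCast_ne_top _) (ENNReal.pow_ne_top enorm_ne_top)) (hbound f))
  let M₀ : lp (fun _ : Q => H) 2 →ₗ[ℂ] lp (fun _ : Q => H) 2 :=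
    { toFun := fun f => ⟨fun q => ∑ r ∈ N q, f r, hmem f⟩
      map_add' := fun f g => lp.ext (funext fun q => Finset.sum_add_distrib)
      map_smul' := fun a f => lp.ext (funext fun q => Finset.smul_sum.symm) }
  refine ⟨M₀.mkContinuous (Real.sqrt (d * d' : ℕ)) fun f => ?_, fun f q => rfl⟩
  have h : ‖M₀ f‖ₑ ^ 2 ≤ (d * d' : ℕ) * ‖f‖ₑ ^ 2 := (enorm_sq_lp_two _).trans_le (hbound f)
  rw [enorm_sq_eq_ofReal, enorm_sq_eq_ofReal, ← ENNReal.ofReal_natCast,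
    ← ENNReal.ofReal_mul (by positivity), ENNReal.ofReal_le_ofReal_iff (by positivity)] at h
  rw [← Real.sqrt_sq (norm_nonneg f), ← Real.sqrt_mul (by positivity)]
  exact Real.le_sqrt_of_sq_le h

end RelationMatrix

/-! ### The Hecke relation on the coset space -/

section HeckeMatrix

variable {G : Type*} [Group G] {Γ : Subgroup G}

open Classical in
/-- The cosets `q'` with `q⁻¹ q' ⊆ ΓσΓ`. -/
noncomputable def heckeRow (hΓ : IsAlmostNormal Γ) (σ : G) (q : G ⧸ Γ) : Finset (G ⧸ Γ) :=
  (hΓ.finite_heckeCosets σ).toFinset.image (q.out • ·)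

theorem mem_heckeRow (hΓ : IsAlmostNormal Γ) (σ : G) (g h : G) :
    (h : G ⧸ Γ) ∈ heckeRow hΓ σ (g : G ⧸ Γ) ↔
      g⁻¹ * h ∈ DoubleCoset.doubleCoset σ (Γ : Set G) Γ := by
  classical
  obtain ⟨γ, hγ⟩ := QuotientGroup.mk_out_eq_mul Γ g
  rw [← mul_mem_doubleCoset_left (Γ.inv_mem γ.2), ← mk_mem_heckeCosets, heckeRow,
    Finset.mem_image, hγ]
  simp only [Set.Finite.mem_toFinset]
  constructor
  · rintro ⟨q, hq, hqh⟩
    rw [← mul_assoc, ← mul_inv_rev]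
    change (g * (γ : G))⁻¹ • (h : G ⧸ Γ) ∈ _
    rwa [← hqh, inv_smul_smul]
  · intro hh
    refine ⟨_, hh, ?_⟩
    change ((g * (γ : G) * ((γ : G)⁻¹ * (g⁻¹ * h)) : G) : G ⧸ Γ) = h
    congr 1
    group

theorem mem_heckeRow_inv (hΓ : IsAlmostNormal Γ) (σ : G) (q r : G ⧸ Γ) :
    r ∈ heckeRow hΓ σ q ↔ q ∈ heckeRow hΓ σ⁻¹ r := by
  obtain ⟨g, rfl⟩ := QuotientGroup.mk_surjective q
  obtain ⟨h, rfl⟩ := QuotientGroup.mk_surjective r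
  rw [mem_heckeRow, mem_heckeRow, ← inv_mem_doubleCoset_inv, mul_inv_rev, inv_inv]

theorem card_heckeRow_le (hΓ : IsAlmostNormal Γ) (σ : G) (q : G ⧸ Γ) :
    (heckeRow hΓ σ q).card ≤ (hΓ.finite_heckeCosets σ).toFinset.card := by
  classical exact Finset.card_image_le

theorem heckeRow_one (hΓ : IsAlmostNormal Γ) (σ : G) :
    heckeRow hΓ σ ((1 : G) : G ⧸ Γ) = (hΓ.finite_heckeCosets σ).toFinset := by
  ext q
  obtain ⟨g, rfl⟩ := QuotientGroup.mk_surjective q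
  rw [mem_heckeRow, Set.Finite.mem_toFinset, mk_mem_heckeCosets, inv_one, one_mul]

/-- The adjacency operator of the Hecke relation `q⁻¹ q' ⊆ ΓσΓ` on `ℓ²(G/Γ) ⊗ H`. -/
noncomputable def heckeMatrix (hΓ : IsAlmostNormal Γ) (σ : G) (H : Type*) [NormedAddCommGroup H]
    [InnerProductSpace ℂ H] :
    lp (fun _ : G ⧸ Γ => H) 2 →L[ℂ] lp (fun _ : G ⧸ Γ => H) 2 :=
  (exists_clm_relation (H := H) (mem_heckeRow_inv hΓ σ) (card_heckeRow_le hΓ σ)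
    (card_heckeRow_le hΓ σ⁻¹)).choose

variable {H : Type*} [NormedAddCommGroup H] [InnerProductSpace ℂ H]

theorem heckeMatrix_apply (hΓ : IsAlmostNormal Γ) (σ : G) (f : lp (fun _ : G ⧸ Γ => H) 2)
    (q : G ⧸ Γ) : heckeMatrix hΓ σ H f q = ∑ r ∈ heckeRow hΓ σ q, f r :=
  (exists_clm_relation (H := H) (mem_heckeRow_inv hΓ σ) (card_heckeRow_le hΓ σ)
    (card_heckeRow_le hΓ σ⁻¹)).choose_spec f q

open Classical in
theorem heckeMatrix_single (hΓ : IsAlmostNormal Γ) (σ : G) (q r : G ⧸ Γ) (x : H) :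
    heckeMatrix hΓ σ H (lp.single 2 r x) q = if r ∈ heckeRow hΓ σ q then x else 0 := by
  rw [heckeMatrix_apply]
  simp_rw [lp.single_apply, Pi.single_apply]
  simp

theorem heckeMatrix_congr (hΓ : IsAlmostNormal Γ) {σ τ : G}
    (h : DoubleCoset.doubleCoset σ (Γ : Set G) Γ = DoubleCoset.doubleCoset τ Γ Γ) :
    heckeMatrix hΓ σ H = heckeMatrix hΓ τ H := by
  have hrow : heckeRow hΓ σ = heckeRow hΓ τ := by
    ext q r
    obtain ⟨g, rfl⟩ := QuotientGroup.mk_surjective q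
    obtain ⟨k, rfl⟩ := QuotientGroup.mk_surjective r
    rw [mem_heckeRow, mem_heckeRow, h]
  refine ContinuousLinearMap.ext fun f => lp.ext (funext fun q => ?_)
  rw [heckeMatrix_apply, heckeMatrix_apply, hrow]

variable [CompleteSpace H]

theorem heckeMatrix_adjoint (hΓ : IsAlmostNormal Γ) (σ : G) :
    ContinuousLinearMap.adjoint (heckeMatrix hΓ σ H) = heckeMatrix hΓ σ⁻¹ H := by
  classical
  refine ContinuousLinearMap.ext fun f => lp.ext (funext fun q => ext_inner_left ℂ fun x => ?_)
  rw [← inner_single_lp, ContinuousLinearMap.adjoint_inner_right, heckeMatrix_apply, inner_sum]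
  have h : heckeMatrix hΓ σ H (lp.single 2 q x) =
      ∑ r ∈ heckeRow hΓ σ⁻¹ q, lp.single 2 r x := by
    refine lp.ext (funext fun r => ?_)
    rw [heckeMatrix_single, lp.coeFn_sum, Finset.sum_apply]
    simp_rw [lp.single_apply, Pi.single_apply]
    simp [mem_heckeRow_inv hΓ σ]
  rw [h, sum_inner]
  simp_rw [inner_single_lp]

end HeckeMatrix

/-! ### The coordinates given by a wandering subspace -/

section Wandering

variable {G : Type*} [Group G] {Γ : Subgroup G} {c : G → G → Circle}
  {H : Type*} [NormedAddCommGroup H] [InnerProductSpace ℂ H]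
  {π : ProjRep G H c} {L : Submodule ℂ H}

theorem IsWandering.inner_eq_zero (hL : IsWandering π Γ L) {g h : G} (hgh : (g : G ⧸ Γ) = h)
    (hne : g ≠ h) {x y : H} (hx : x ∈ L) (hy : y ∈ L) : ⟪π.toFun g x, π.toFun h y⟫_ℂ = 0 := by
  have hne' : h⁻¹ * g ≠ 1 := fun e => hne (inv_mul_eq_one.mp e).symm
  have h0 := hL.ortho _ (QuotientGroup.eq.1 hgh.symm) hne' x hx y hy
  rw [← (π.toFun h).apply_symm_apply (π.toFun g x), π.symm_apply, map_smul, inner_smul_left,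
    LinearIsometryEquiv.inner_map_map, h0, mul_zero]

variable [CompleteSpace L]

theorem inner_coe_orthogonalProjectionOnto (m : L) (x : H) :
    ⟪m, L.orthogonalProjectionOnto x⟫_ℂ = ⟪(m : H), x⟫_ℂ := by
  rw [Submodule.inner_orthogonalProjectionOnto_eq_of_mem_left]

theorem orthogonalProjectionOnto_eq_zero_of_inner {x : H} (h : ∀ l ∈ L, ⟪l, x⟫_ℂ = 0) :
    L.orthogonalProjectionOnto x = 0 :=
  ext_inner_left ℂ fun m => by
    rw [inner_coe_orthogonalProjectionOnto, h m m.2, inner_zero_right]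

variable [CompleteSpace H]

theorem IsWandering.equiv_symm_single {_ : DecidableEq Γ} (hL : IsWandering π Γ L) (γ : Γ) (l : L) :
    hL.equiv.symm (lp.single 2 γ l) = π.toFun γ l :=
  hL.isHilbertSum.linearIsometryEquiv_symm_apply_single l

/-- The `γ`-coordinate in `H ≅ ℓ²(Γ; L)` is `P_L π(γ)⁻¹`. -/
theorem IsWandering.equiv_apply (hL : IsWandering π Γ L) (x : H) (γ : Γ) :
    hL.equiv x γ = L.orthogonalProjectionOnto ((π.toFun γ).symm x) := by
  classical
  refine ext_inner_left ℂ fun m => ?_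
  rw [← inner_single_lp, ← hL.equiv.symm.inner_map_map, hL.equiv_symm_single,
    LinearIsometryEquiv.symm_apply_apply, inner_coe_orthogonalProjectionOnto,
    LinearIsometryEquiv.inner_map_eq_flip]

/-- Parseval's identity for `H ≅ ℓ²(Γ; L)`. -/
theorem IsWandering.tsum_enorm_sq (hL : IsWandering π Γ L) (x : H) :
    ∑' γ : Γ, ‖L.orthogonalProjectionOnto ((π.toFun γ).symm x)‖ₑ ^ 2 = ‖x‖ₑ ^ 2 := by
  simp_rw [← hL.equiv_apply]
  rw [← enorm_sq_lp_two]
  simp [enorm_eq_nnnorm]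

theorem IsWandering.hasSum_proj (hL : IsWandering π Γ L) (x : H) :
    HasSum (fun γ : Γ => π.toFun γ (L.starProjection ((π.toFun γ).symm x))) x := by
  have h := hL.isHilbertSum.hasSum_linearIsometryEquiv_symm (hL.equiv x)
  have e : hL.isHilbertSum.linearIsometryEquiv.symm (hL.equiv x) = x :=
    hL.equiv.symm_apply_apply x
  rw [e] at h
  convert h using 2 with γ
  rw [hL.equiv_apply]
  rfl

theorem IsWandering.eq_zero (hL : IsWandering π Γ L) {x : H}
    (hx : ∀ γ : Γ, ∀ l ∈ L, ⟪π.toFun γ l, x⟫_ℂ = 0) : x = 0 := by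
  apply hL.equiv.injective
  rw [map_zero]
  refine lp.ext (funext fun γ => ?_)
  rw [hL.equiv_apply]
  refine orthogonalProjectionOnto_eq_zero_of_inner fun l hl => ?_
  rw [← (π.toFun γ).inner_map_map, LinearIsometryEquiv.apply_symm_apply, hx γ l hl]

/-- Bounded operators are determined by their values on the subspaces `π(γ) L`. -/
theorem IsWandering.clm_ext (hL : IsWandering π Γ L) {F : Type*} [NormedAddCommGroup F]
    [NormedSpace ℂ F] {S T : H →L[ℂ] F}
    (h : ∀ γ : Γ, ∀ l ∈ L, S (π.toFun γ l) = T (π.toFun γ l)) : S = T := by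
  refine ContinuousLinearMap.ext fun x => ?_
  have hx := hL.hasSum_proj x
  refine (hx.mapL S).unique ?_
  simp_rw [h _ _ (L.starProjection_apply_mem _)]
  exact hx.mapL T

/-! ### `ℓ²(G) ⊗ L` as `ℓ²(G/Γ) ⊗ H` -/

omit [CompleteSpace L] [CompleteSpace H] in
open Classical in
variable (π Γ L) in
/-- `l ↦ δ_{gΓ} ⊗ π(g) l`. -/
noncomputable def cosetIsometry (g : G) : L →ₗᵢ[ℂ] lp (fun _ : G ⧸ Γ => H) 2 where
  toLinearMap := (lp.singleContinuousLinearMap ℂ (fun _ : G ⧸ Γ => H) 2 (g : G ⧸ Γ)).toLinearMap ∘ₗ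
    (π.toFun g).toLinearEquiv.toLinearMap ∘ₗ L.subtype
  norm_map' l := by
    refine (lp.norm_single (by norm_num) _ _).trans ?_
    simp

omit [CompleteSpace L] [CompleteSpace H] in
open Classical in
theorem cosetIsometry_apply (g : G) (l : L) :
    cosetIsometry Γ π L g l = lp.single 2 (g : G ⧸ Γ) (π.toFun g l) := rfl

/-- The vectors `δ_{gΓ} ⊗ π(g) l` exhibit `ℓ²(G/Γ) ⊗ H` as the Hilbert sum of copies of `L` indexed
by `G`: on the fibre of a coset `gΓ` this is the decomposition of `H` by the wandering subspace,
moved by `π(g)`. -/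
theorem IsWandering.isHilbertSum_coset (hL : IsWandering π Γ L) :
    IsHilbertSum ℂ (fun _ : G => L) (cosetIsometry Γ π L) := by
  classical
  refine IsHilbertSum.mk ?_ ?_
  · intro g h hne x y
    change ⟪(lp.single 2 (g : G ⧸ Γ) (π.toFun g x) : lp (fun _ : G ⧸ Γ => H) 2),
      lp.single 2 (h : G ⧸ Γ) (π.toFun h y)⟫_ℂ = 0
    rw [inner_single_lp, lp.single_apply, Pi.single_apply]
    split_ifs with hq
    · exact hL.inner_eq_zero hq hne x.2 y.2
    · exact inner_zero_right _
  · rw [top_le_iff, Submodule.topologicalClosure_eq_top_iff, Submodule.eq_bot_iff]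
    intro F hF
    refine lp.ext (funext fun q => ?_)
    obtain ⟨g, rfl⟩ := QuotientGroup.mk_surjective q
    apply (π.toFun g).symm.injective
    refine (hL.eq_zero fun γ l hl => ?_).trans (map_zero _).symm
    have h := (Submodule.mem_orthogonal _ _).1 hF (cosetIsometry Γ π L (g * γ) ⟨l, hl⟩)
      ((le_iSup (fun g => LinearMap.range (cosetIsometry Γ π L g).toLinearMap) (g * γ)) ⟨_, rfl⟩)
    have e : ((g * γ : G) : G ⧸ Γ) = g := QuotientGroup.mk_mul_of_mem g γ.2
    rw [cosetIsometry_apply, inner_single_lp, e] at h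
    rw [← LinearIsometryEquiv.inner_map_eq_flip, π.mul_apply, inner_smul_left, h, mul_zero]

/-- The identification of `ℓ²(G/Γ) ⊗ H` with `ℓ²(G) ⊗ L`, sending `δ_{gΓ} ⊗ π(g) l` to
`δ_g ⊗ l`. -/
noncomputable def IsWandering.cosetEquiv (hL : IsWandering π Γ L) :
    lp (fun _ : G ⧸ Γ => H) 2 ≃ₗᵢ[ℂ] lp (fun _ : G => L) 2 :=
  hL.isHilbertSum_coset.linearIsometryEquiv

open Classical in
theorem IsWandering.cosetEquiv_symm_single (hL : IsWandering π Γ L) (g : G) (l : L) :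
    hL.cosetEquiv.symm (lp.single 2 g l) = lp.single 2 (g : G ⧸ Γ) (π.toFun g l) :=
  hL.isHilbertSum_coset.linearIsometryEquiv_symm_apply_single l

theorem IsWandering.cosetEquiv_apply (hL : IsWandering π Γ L) (F : lp (fun _ : G ⧸ Γ => H) 2)
    (g : G) : hL.cosetEquiv F g = L.orthogonalProjectionOnto ((π.toFun g).symm (F g)) := by
  classical
  refine ext_inner_left ℂ fun m => ?_
  rw [← inner_single_lp, ← hL.cosetEquiv.symm.inner_map_map, hL.cosetEquiv_symm_single,
    LinearIsometryEquiv.symm_apply_apply, inner_coe_orthogonalProjectionOnto, inner_single_lp,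
    LinearIsometryEquiv.inner_map_eq_flip]

/-- The part of `ℓ²(G) ⊗ L` over `Γ` is the fibre of `ℓ²(G/Γ) ⊗ H` at the trivial coset. -/
theorem IsWandering.restrict_cosetEquiv (hL : IsWandering π Γ L)
    (F : lp (fun _ : G ⧸ Γ => H) 2) :
    restrict Γ L (hL.cosetEquiv F) = hL.equiv (F ((1 : G) : G ⧸ Γ)) := by
  refine lp.ext (funext fun γ => ?_)
  change hL.cosetEquiv F (γ : G) = _
  have e : ((γ : G) : G ⧸ Γ) = (1 : G) := QuotientGroup.eq.2 (by simp)
  rw [hL.cosetEquiv_apply, hL.equiv_apply, e]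

open Classical in
theorem IsWandering.cosetEquiv_symm_adjoint_restrict (hL : IsWandering π Γ L)
    (f : lp (fun _ : Γ => L) 2) :
    hL.cosetEquiv.symm (ContinuousLinearMap.adjoint (restrict Γ L) f) =
      lp.single 2 ((1 : G) : G ⧸ Γ) (hL.equiv.symm f) := by
  refine ext_inner_right ℂ fun F => ?_
  rw [← hL.cosetEquiv.inner_map_map, LinearIsometryEquiv.apply_symm_apply,
    ContinuousLinearMap.adjoint_inner_left, hL.restrict_cosetEquiv, inner_single_lp,
    ← hL.equiv.inner_map_map, LinearIsometryEquiv.apply_symm_apply]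

end Wandering

/-! ### Convolutors as operators on `ℓ²(G/Γ) ⊗ H` -/

section Convolutors

variable {G : Type*} [Group G] {Γ : Subgroup G} {c : G → G → Circle}
  {H₁ : Type*} [NormedAddCommGroup H₁] [InnerProductSpace ℂ H₁] [CompleteSpace H₁]
  {H₂ : Type*} [NormedAddCommGroup H₂] [InnerProductSpace ℂ H₂] [CompleteSpace H₂]
  {H₃ : Type*} [NormedAddCommGroup H₃] [InnerProductSpace ℂ H₃] [CompleteSpace H₃]
  {π₁ : ProjRep G H₁ c} {L₁ : Submodule ℂ H₁} [CompleteSpace L₁]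
  {π₂ : ProjRep G H₂ c} {L₂ : Submodule ℂ H₂} [CompleteSpace L₂]
  {π₃ : ProjRep G H₃ c} {L₃ : Submodule ℂ H₃} [CompleteSpace L₃]

/-- An operator from `ℓ²(G/Γ) ⊗ H₁` to `ℓ²(G/Γ) ⊗ H₂`, seen as an operator from `ℓ²(G) ⊗ L₁` to
`ℓ²(G) ⊗ L₂`. -/
noncomputable def cosetTransport (hL₁ : IsWandering π₁ Γ L₁) (hL₂ : IsWandering π₂ Γ L₂)
    (N : lp (fun _ : G ⧸ Γ => H₁) 2 →L[ℂ] lp (fun _ : G ⧸ Γ => H₂) 2) :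
    lp (fun _ : G => L₁) 2 →L[ℂ] lp (fun _ : G => L₂) 2 :=
  hL₂.cosetEquiv.toContinuousLinearEquiv.toContinuousLinearMap ∘L N ∘L
    hL₁.cosetEquiv.symm.toContinuousLinearEquiv.toContinuousLinearMap

theorem cosetTransport_apply (hL₁ : IsWandering π₁ Γ L₁) (hL₂ : IsWandering π₂ Γ L₂)
    (N : lp (fun _ : G ⧸ Γ => H₁) 2 →L[ℂ] lp (fun _ : G ⧸ Γ => H₂) 2)
    (f : lp (fun _ : G => L₁) 2) :
    cosetTransport hL₁ hL₂ N f = hL₂.cosetEquiv (N (hL₁.cosetEquiv.symm f)) := rfl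

theorem cosetTransport_comp (hL₁ : IsWandering π₁ Γ L₁) (hL₂ : IsWandering π₂ Γ L₂)
    (hL₃ : IsWandering π₃ Γ L₃)
    (N : lp (fun _ : G ⧸ Γ => H₂) 2 →L[ℂ] lp (fun _ : G ⧸ Γ => H₃) 2)
    (M : lp (fun _ : G ⧸ Γ => H₁) 2 →L[ℂ] lp (fun _ : G ⧸ Γ => H₂) 2) :
    cosetTransport hL₂ hL₃ N ∘L cosetTransport hL₁ hL₂ M = cosetTransport hL₁ hL₃ (N ∘L M) := by
  refine ContinuousLinearMap.ext fun f => ?_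
  simp [cosetTransport_apply]

theorem cosetTransport_adjoint (hL₁ : IsWandering π₁ Γ L₁) (hL₂ : IsWandering π₂ Γ L₂)
    (N : lp (fun _ : G ⧸ Γ => H₁) 2 →L[ℂ] lp (fun _ : G ⧸ Γ => H₂) 2) :
    ContinuousLinearMap.adjoint (cosetTransport hL₁ hL₂ N) =
      cosetTransport hL₂ hL₁ (ContinuousLinearMap.adjoint N) := by
  symm
  rw [ContinuousLinearMap.eq_adjoint_iff]
  intro f g
  rw [cosetTransport_apply, cosetTransport_apply, ← hL₁.cosetEquiv.symm.inner_map_map,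
    LinearIsometryEquiv.symm_apply_apply, ContinuousLinearMap.adjoint_inner_left,
    ← hL₂.cosetEquiv.inner_map_map, LinearIsometryEquiv.apply_symm_apply]

open Classical in
theorem cosetTransport_single (hL₁ : IsWandering π₁ Γ L₁) (hL₂ : IsWandering π₂ Γ L₂)
    (N : lp (fun _ : G ⧸ Γ => H₁) 2 →L[ℂ] lp (fun _ : G ⧸ Γ => H₂) 2) (h k : G) (l : L₁) :
    cosetTransport hL₁ hL₂ N (lp.single 2 h l) k =
      L₂.orthogonalProjectionOnto ((π₂.toFun k).symm
        (N (lp.single 2 (h : G ⧸ Γ) (π₁.toFun h l)) (k : G ⧸ Γ))) := by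
  rw [cosetTransport_apply, hL₂.cosetEquiv_apply, hL₁.cosetEquiv_symm_single]

open Classical in
/-- The conditional expectation picks the matrix entry at the trivial coset. -/
theorem condExp_cosetTransport (hL₁ : IsWandering π₁ Γ L₁) (hL₂ : IsWandering π₂ Γ L₂)
    {N : lp (fun _ : G ⧸ Γ => H₁) 2 →L[ℂ] lp (fun _ : G ⧸ Γ => H₂) 2} {Y : H₁ →L[ℂ] H₂}
    (hY : ∀ x, N (lp.single 2 ((1 : G) : G ⧸ Γ) x) ((1 : G) : G ⧸ Γ) = Y x) :
    condExp (L₁ := L₁) (L₂ := L₂) Γ (cosetTransport hL₁ hL₂ N) = transport hL₁ hL₂ Y := by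
  refine ContinuousLinearMap.ext fun f => ?_
  change restrict Γ L₂ (cosetTransport hL₁ hL₂ N (ContinuousLinearMap.adjoint (restrict Γ L₁) f)) =
    hL₂.equiv (Y (hL₁.equiv.symm f))
  rw [cosetTransport_apply, hL₂.restrict_cosetEquiv, hL₁.cosetEquiv_symm_adjoint_restrict, hY]

/-- The convolutor `S(ΓσΓ)` is the Hecke matrix. -/
theorem represents_series (hΓ : IsAlmostNormal Γ) (hL₁ : IsWandering π₁ Γ L₁) (σ : G) :
    Represents c (series π₁ L₁ (DoubleCoset.doubleCoset σ Γ Γ))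
      (cosetTransport hL₁ hL₁ (heckeMatrix hΓ σ H₁)) := by
  intro h l k
  rw [cosetTransport_single, heckeMatrix_single, series]
  by_cases hD : k⁻¹ * h ∈ DoubleCoset.doubleCoset σ (Γ : Set G) Γ
  · rw [if_pos ((mem_heckeRow hΓ σ k h).2 hD), Set.indicator_of_mem hD, π₁.symm_apply, map_smul]
    rfl
  · rw [if_neg (fun h' => hD ((mem_heckeRow hΓ σ k h).1 h')), Set.indicator_of_notMem hD]
    simp

/-- The operator `⊕ π₂(t) X π₁(t)⁻¹` over the cosets `tΓ`. -/
noncomputable def diagonalConj (π₁ : ProjRep G H₁ c) (π₂ : ProjRep G H₂ c) (Γ : Subgroup G)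
    (X : H₁ →L[ℂ] H₂) : lp (fun _ : G ⧸ Γ => H₁) 2 →L[ℂ] lp (fun _ : G ⧸ Γ => H₂) 2 :=
  lp.mapCLM 2 (fun q : G ⧸ Γ => conjOp π₁ π₂ q.out X) (norm_nonneg X)
    fun q => norm_conjOp_le π₁ π₂ q.out X

omit [CompleteSpace H₁] [CompleteSpace H₂] in
theorem diagonalConj_apply (X : H₁ →L[ℂ] H₂) (f : lp (fun _ : G ⧸ Γ => H₁) 2) (q : G ⧸ Γ) :
    diagonalConj π₁ π₂ Γ X f q = conjOp π₁ π₂ q.out X (f q) := rfl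

/-- The convolutor on `ℓ²(G)` with the coefficients of an intertwiner `X` is block diagonal. -/
theorem represents_extendZero (hL₁ : IsWandering π₁ Γ L₁) (hL₂ : IsWandering π₂ Γ L₂)
    {X : H₁ →L[ℂ] H₂} (hX : X ∈ intertwiners π₁ π₂ Γ) :
    Represents c (extendZero Γ (intCoeff π₂ Γ L₁ L₂ X))
      (cosetTransport hL₁ hL₂ (diagonalConj π₁ π₂ Γ X)) := by
  classical
  intro h l k
  rw [cosetTransport_single, diagonalConj_apply, conjOp_out hX, lp.single_apply, Pi.single_apply,
    extendZero]
  by_cases hD : k⁻¹ * h ∈ Γ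
  · have e : (k : G ⧸ Γ) = h := QuotientGroup.eq.2 hD
    rw [if_pos e, dif_pos hD, conjOp_congr_coset hX e, conjOp_apply,
      LinearIsometryEquiv.symm_apply_apply, π₂.symm_apply, map_smul]
    rfl
  · rw [if_neg (fun e => hD (QuotientGroup.eq.1 e)), dif_neg hD]
    simp

/-- The `ΓσΓ`-Hecke operator is the entry at the trivial coset of the product of the Hecke matrix,
the block diagonal matrix of `X` and the adjoint Hecke matrix. -/
theorem transport_hecke (hΓ : IsAlmostNormal Γ) (hL₁ : IsWandering π₁ Γ L₁)
    (hL₂ : IsWandering π₂ Γ L₂) (σ : G) (X : H₁ →L[ℂ] H₂) :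
    transport hL₁ hL₂ (hecke π₁ π₂ Γ σ X) =
      condExp (L₁ := L₁) (L₂ := L₂) Γ (cosetTransport hL₂ hL₂ (heckeMatrix hΓ σ H₂) ∘L
        cosetTransport hL₁ hL₂ (diagonalConj π₁ π₂ Γ X) ∘L
        ContinuousLinearMap.adjoint (cosetTransport hL₁ hL₁ (heckeMatrix hΓ σ H₁))) := by
  rw [cosetTransport_adjoint, heckeMatrix_adjoint, cosetTransport_comp, cosetTransport_comp]
  symm
  refine condExp_cosetTransport hL₁ hL₂ fun x => ?_
  rw [ContinuousLinearMap.comp_apply, ContinuousLinearMap.comp_apply, heckeMatrix_apply,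
    hecke_eq_sum hΓ, heckeRow_one, sum_apply]
  refine Finset.sum_congr rfl fun q hq => ?_
  rw [← heckeRow_one hΓ, mem_heckeRow_inv] at hq
  rw [diagonalConj_apply, heckeMatrix_single, if_pos hq]

/-! ### Intertwiners as convolutors on `ℓ²(Γ)` -/

theorem transport_single {_ : DecidableEq Γ} (hL₁ : IsWandering π₁ Γ L₁) (hL₂ : IsWandering π₂ Γ L₂)
    (X : H₁ →L[ℂ] H₂) (h k : Γ) (l : L₁) :
    transport hL₁ hL₂ X (lp.single 2 h l) k =
      L₂.orthogonalProjectionOnto ((π₂.toFun k).symm (X (π₁.toFun h l))) := by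
  change hL₂.equiv (X (hL₁.equiv.symm (lp.single 2 h l))) k = _
  rw [hL₂.equiv_apply, hL₁.equiv_symm_single]

theorem represents_transport (hc : ∀ γ ∈ Γ, ∀ γ' ∈ Γ, c γ γ' = 1) (hL₁ : IsWandering π₁ Γ L₁)
    (hL₂ : IsWandering π₂ Γ L₂) {X : H₁ →L[ℂ] H₂} (hX : X ∈ intertwiners π₁ π₂ Γ) :
    Represents (fun _ _ => 1) (intCoeff π₂ Γ L₁ L₂ X) (transport hL₁ hL₂ X) := by
  intro h l k
  rw [transport_single, hX _ h.2, π₂.symm_eq_inv hc k.2, π₂.mul_apply_of_mem hc (Γ.inv_mem k.2) h.2]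
  simp [intCoeff]

/-- An operator whose matrix entries depend only on `k⁻¹h` commutes with left translations. -/
theorem mem_intertwiners_of_represents (hc : ∀ γ ∈ Γ, ∀ γ' ∈ Γ, c γ γ' = 1)
    (hL₁ : IsWandering π₁ Γ L₁) (hL₂ : IsWandering π₂ Γ L₂) {X : H₁ →L[ℂ] H₂}
    {A : Γ → L₁ →L[ℂ] L₂} (hA : Represents (fun _ _ => 1) A (transport hL₁ hL₂ X)) :
    X ∈ intertwiners π₁ π₂ Γ := by
  have hA' : ∀ (h k : Γ) (l : L₁),
      L₂.orthogonalProjectionOnto ((π₂.toFun k).symm (X (π₁.toFun h l))) = A (k⁻¹ * h) l := by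
    intro h k l
    have hh := hA h l k
    rw [Circle.coe_one, map_one, one_smul] at hh
    exact (transport_single hL₁ hL₂ X h k l).symm.trans hh
  refine mem_intertwiners_iff_conjOp.2 fun γ hγ => hL₁.clm_ext fun h l hl => ?_
  apply hL₂.equiv.injective
  refine lp.ext (funext fun k => ?_)
  -- the entries at `(k, h)` and at `(γ⁻¹k, γ⁻¹h)` agree
  have h1 := hA' h k ⟨l, hl⟩
  have h2 := hA' (⟨γ, hγ⟩⁻¹ * h) (⟨γ, hγ⟩⁻¹ * k) ⟨l, hl⟩
  rw [hL₂.equiv_apply, hL₂.equiv_apply, h1, conjOp_apply, π₁.symm_eq_inv hc hγ,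
    π₁.mul_apply_of_mem hc (Γ.inv_mem hγ) h.2, π₂.symm_eq_inv hc k.2,
    π₂.mul_apply_of_mem hc (Γ.inv_mem k.2) hγ]
  rw [π₂.symm_eq_inv hc (Subtype.property _)] at h2
  convert h2 using 3
  · simp only [Subgroup.coe_mul, Subgroup.coe_inv, mul_inv_rev, inv_inv]
  · rfl
  · rw [mul_inv_rev, inv_inv, mul_assoc, mul_inv_cancel_left]

end Convolutors

/-! ### Hilbert–Schmidt operators in arbitrary bases -/

section HilbertSchmidt

variable {H₁ : Type*} [NormedAddCommGroup H₁] [InnerProductSpace ℂ H₁] [CompleteSpace H₁]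
  {H₂ : Type*} [NormedAddCommGroup H₂] [InnerProductSpace ℂ H₂] [CompleteSpace H₂]
  {H₃ : Type*} [NormedAddCommGroup H₃] [InnerProductSpace ℂ H₃] [CompleteSpace H₃]

theorem HS.enorm_sq (X : HS H₁ H₂) : ‖X‖ₑ ^ 2 = hsSq X.op := by
  rw [enorm_sq_eq_ofReal, HS.sq_norm]

/-- The coordinates of a Hilbert–Schmidt operator in a Hilbert basis. -/
noncomputable def HS.coordIn {ι : Type*} (b : HilbertBasis ι ℂ H₁) :
    HS H₁ H₂ →ₗᵢ[ℂ] lp (fun _ : ι => H₂) 2 where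
  toFun X := ⟨fun i => X.op (b i),
    memℓp_two_iff_enorm.2 (by rw [← hsSq_eq b]; exact X.isHS.ne)⟩
  map_add' _ _ := rfl
  map_smul' _ _ := rfl
  norm_map' X := by
    refine (pow_left_inj₀ (norm_nonneg _) (norm_nonneg _) two_ne_zero).1 ?_
    refine (ENNReal.ofReal_eq_ofReal_iff (by positivity) (by positivity)).1 ?_
    rw [← enorm_sq_eq_ofReal, ← enorm_sq_eq_ofReal, HS.enorm_sq, hsSq_eq b, enorm_sq_lp_two]
    rfl

/-- The Hilbert–Schmidt inner product can be computed in any Hilbert basis. -/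
theorem HS.hasSum_inner {ι : Type*} (b : HilbertBasis ι ℂ H₁) (X Y : HS H₁ H₂) :
    HasSum (fun i => ⟪X.op (b i), Y.op (b i)⟫_ℂ) ⟪X, Y⟫_ℂ := by
  rw [← (HS.coordIn b).inner_map_map]
  exact lp.hasSum_inner (HS.coordIn b X) (HS.coordIn b Y)

omit [CompleteSpace H₁] [CompleteSpace H₂] in
theorem enorm_clm_apply_sq_le (T : H₁ →L[ℂ] H₂) (x : H₁) : ‖T x‖ₑ ^ 2 ≤ ‖T‖ₑ ^ 2 * ‖x‖ₑ ^ 2 := by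
  rw [← mul_pow]
  gcongr
  exact T.le_opENorm x

omit [CompleteSpace H₂] [CompleteSpace H₃] in
theorem hsSq_comp_le (T : H₂ →L[ℂ] H₃) (X : H₁ →L[ℂ] H₂) :
    hsSq (T ∘L X) ≤ ‖T‖ₑ ^ 2 * hsSq X := by
  rw [hsSq, hsSq, ← ENNReal.tsum_mul_left]
  exact ENNReal.tsum_le_tsum fun i => enorm_clm_apply_sq_le T _

theorem hsSq_comp_le_right (X : H₂ →L[ℂ] H₃) (T : H₁ →L[ℂ] H₂) :
    hsSq (X ∘L T) ≤ ‖T‖ₑ ^ 2 * hsSq X := by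
  rw [← hsSq_adjoint, ContinuousLinearMap.adjoint_comp, ← hsSq_adjoint X]
  refine (hsSq_comp_le _ _).trans_eq ?_
  congr 2
  simp [enorm_eq_nnnorm]

theorem IsHS.comp_right {X : H₂ →L[ℂ] H₃} (hX : IsHS X) (T : H₁ →L[ℂ] H₂) : IsHS (X ∘L T) :=
  (hsSq_comp_le_right X T).trans_lt (ENNReal.mul_lt_top (ENNReal.pow_lt_top enorm_lt_top) hX)

theorem trace_adjoint_comp {L : Submodule ℂ H₁} [CompleteSpace L] (X : H₁ →L[ℂ] H₂) :
    trace L (ContinuousLinearMap.adjoint X ∘L X) = ∑' i, ‖X (stdBasis L i)‖ₑ ^ 2 := by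
  refine tsum_congr fun i => ?_
  rw [ContinuousLinearMap.comp_apply, ContinuousLinearMap.adjoint_inner_right,
    enorm_sq_eq_ofReal, inner_self_eq_norm_sq]

end HilbertSchmidt

/-! ### The Hilbert basis adapted to a wandering subspace -/

section AdaptedBasis

variable {G : Type*} [Group G] {Γ : Subgroup G} {c : G → G → Circle}
  {H : Type*} [NormedAddCommGroup H] [InnerProductSpace ℂ H] [CompleteSpace H]
  {π : ProjRep G H c} {L : Submodule ℂ H} [CompleteSpace L]

omit [CompleteSpace H] in
theorem IsWandering.orthonormal (hL : IsWandering π Γ L) :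
    Orthonormal ℂ fun p : Γ × basisIdx L => π.toFun p.1 (stdBasis L p.2 : H) := by
  refine ⟨fun p => ?_, fun p q hpq => ?_⟩
  · rw [LinearIsometryEquiv.norm_map]
    exact (stdBasis L).orthonormal.1 p.2
  · by_cases h : p.1 = q.1
    · simp only [h, LinearIsometryEquiv.inner_map_map]
      exact (stdBasis L).orthonormal.2 fun h' => hpq (Prod.ext h h')
    · refine hL.inner_eq_zero (QuotientGroup.eq.2 ?_) (fun h' => h (Subtype.ext h'))
        (Subtype.property _) (Subtype.property _)
      exact Γ.mul_mem (Γ.inv_mem p.1.2) q.1.2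

theorem IsWandering.orthogonal_eq_bot (hL : IsWandering π Γ L) :
    (Submodule.span ℂ
      (Set.range fun p : Γ × basisIdx L => π.toFun p.1 (stdBasis L p.2 : H)))ᗮ = ⊥ := by
  rw [Submodule.eq_bot_iff]
  intro x hx
  apply hL.equiv.injective
  rw [map_zero]
  refine lp.ext (funext fun γ => ?_)
  apply (stdBasis L).repr.injective
  refine lp.ext (funext fun i => ?_)
  rw [HilbertBasis.repr_apply_apply, hL.equiv_apply, inner_coe_orthogonalProjectionOnto,
    ← LinearIsometryEquiv.inner_map_eq_flip,
    (Submodule.mem_orthogonal _ _).1 hx _ (Submodule.subset_span ⟨(γ, i), rfl⟩)]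
  simp

/-- The vectors `π(γ) e_i`, with `(e_i)` a Hilbert basis of the wandering subspace. -/
noncomputable def IsWandering.basis (hL : IsWandering π Γ L) :
    HilbertBasis (Γ × basisIdx L) ℂ H :=
  HilbertBasis.mkOfOrthogonalEqBot hL.orthonormal hL.orthogonal_eq_bot

theorem IsWandering.basis_apply (hL : IsWandering π Γ L) (p : Γ × basisIdx L) :
    hL.basis p = π.toFun p.1 (stdBasis L p.2 : H) :=
  congrFun (HilbertBasis.coe_mkOfOrthogonalEqBot hL.orthonormal hL.orthogonal_eq_bot) p

omit [CompleteSpace H] [CompleteSpace L] in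
theorem IsWandering.map_mem_orthogonal (hL : IsWandering π Γ L)
    {γ : G} (hγ : γ ∈ Γ) (hne : γ ≠ 1) {x : H} (hx : x ∈ L) : π.toFun γ x ∈ Lᗮ := by
  rw [Submodule.mem_orthogonal']
  exact fun y hy => hL.ortho γ hγ hne x hx y hy

variable {F : Type*} [NormedAddCommGroup F] [InnerProductSpace ℂ F] [CompleteSpace F]

theorem IsWandering.hsSq_eq_tsum (hL : IsWandering π Γ L) (X : H →L[ℂ] F) :
    hsSq X = ∑' (γ : Γ) (i : basisIdx L), ‖X (π.toFun γ (stdBasis L i : H))‖ₑ ^ 2 := by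
  rw [hsSq_eq hL.basis, ← ENNReal.tsum_prod]
  simp_rw [hL.basis_apply]

theorem IsWandering.enorm_sq_eq_tsum (hL : IsWandering π Γ L) (x : H) :
    ‖x‖ₑ ^ 2 = ∑' (γ : Γ) (i : basisIdx L), ‖⟪π.toFun γ (stdBasis L i : H), x⟫_ℂ‖ₑ ^ 2 := by
  rw [← parseval hL.basis, ← ENNReal.tsum_prod]
  simp_rw [hL.basis_apply]

/-- Only the basis vectors in `L` itself contribute to the Hilbert–Schmidt norm of `X P_L`. -/
theorem IsWandering.hsSq_comp_starProjection (hc : c 1 1 = 1) (hL : IsWandering π Γ L)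
    (X : H →L[ℂ] F) :
    hsSq (X ∘L L.starProjection) = ∑' i, ‖X (stdBasis L i : H)‖ₑ ^ 2 := by
  rw [hL.hsSq_eq_tsum, tsum_eq_single 1]
  · refine tsum_congr fun i => ?_
    rw [OneMemClass.coe_one, π.map_one_apply hc, ContinuousLinearMap.comp_apply,
      Submodule.starProjection_eq_self_iff.2 (Subtype.property _)]
  · intro γ hγ
    refine ENNReal.tsum_eq_zero.2 fun i => ?_
    rw [ContinuousLinearMap.comp_apply, L.starProjection_apply_eq_zero_iff.2
      (hL.map_mem_orthogonal γ.2 (fun h => hγ (Subtype.ext h)) (Subtype.property _))]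
    simp

/-- The inner product with an element of `{Z : Z = Z P_L}` is a sum over a basis of `L`. -/
theorem IsWandering.hasSum_hs_inner (hc : c 1 1 = 1) (hL : IsWandering π Γ L)
    {Z : HS H F} (hZ : Z ∈ rightSupported F L) (Y : HS H F) :
    HasSum (fun i => ⟪Y.op (stdBasis L i : H), Z.op (stdBasis L i : H)⟫_ℂ) ⟪Y, Z⟫_ℂ := by
  have h := HS.hasSum_inner hL.basis Y Z
  have hinj : Function.Injective fun i : basisIdx L => ((1 : Γ), i) :=
    fun i j hij => (Prod.ext_iff.1 hij).2
  rw [← hinj.hasSum_iff] at h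
  · convert h using 3 with i
    all_goals simp only [Function.comp_apply, hL.basis_apply, OneMemClass.coe_one,
      π.map_one_apply hc]
  · rintro ⟨γ, i⟩ hp
    have hγ : (γ : G) ≠ 1 := fun h1 => hp ⟨i, Prod.ext (Subtype.ext h1.symm) rfl⟩
    rw [hL.basis_apply,
      hZ _ (hL.map_mem_orthogonal γ.2 hγ (Subtype.property _)), inner_zero_right]

theorem isHS_op_comp_starProjection (Y : HS H F) : IsHS (Y.op ∘L L.starProjection) :=
  Y.isHS.comp_right _

theorem toRight_op_apply (X : H →L[ℂ] F) (h : IsHS (X ∘L L.starProjection)) (x : H) :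
    (toRight L X h : HS H F).op x = X (L.starProjection x) := rfl

/-- Elements of `{Y : Y = Y P_L}` are determined by their restriction to `L`. -/
theorem rightSupported_ext {Y Z : rightSupported F L}
    (h : ∀ l ∈ L, (Y : HS H F).op l = (Z : HS H F).op l) : Y = Z := by
  refine Subtype.ext (HS.ext fun x => ?_)
  rw [← L.starProjection_add_starProjection_orthogonal x, map_add, map_add,
    h _ (L.starProjection_apply_mem x), Y.2 _ (Submodule.starProjection_apply_mem _ _),
    Z.2 _ (Submodule.starProjection_apply_mem _ _)]

theorem toRight_op_of_mem (X : H →L[ℂ] F) (h : IsHS (X ∘L L.starProjection)) {x : H} (hx : x ∈ L) :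
    (toRight L X h : HS H F).op x = X x := by
  rw [toRight_op_apply, Submodule.starProjection_eq_self_iff.2 hx]

/-- The orthogonal projection onto `{Y : Y = Y P_L}` is `Y ↦ Y P_L`. -/
theorem IsWandering.orthogonalProjectionOnto_rightSupported (hc : c 1 1 = 1)
    (hL : IsWandering π Γ L) (Y : HS H F) :
    (rightSupported F L).orthogonalProjectionOnto Y =
      toRight L Y.op (isHS_op_comp_starProjection Y) := by
  refine Subtype.ext ((rightSupported F L).eq_starProjection_of_mem_of_inner_eq_zero
    (Subtype.property _) fun Z hZ => ?_)
  refine (hL.hasSum_hs_inner hc hZ _).unique ?_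
  convert hasSum_zero with i
  have h : (Y - (toRight L Y.op (isHS_op_comp_starProjection Y) : HS H F)).op (stdBasis L i : H) =
      Y.op (stdBasis L i : H) -
        (toRight L Y.op (isHS_op_comp_starProjection Y) : HS H F).op (stdBasis L i : H) := rfl
  rw [h, toRight_op_of_mem _ _ (Subtype.property _), sub_self, inner_zero_left]

end AdaptedBasis

/-! ### The `L²`-space of intertwiners -/

section L2Intertwiners

variable {G : Type*} [Group G] {Γ : Subgroup G} {c : G → G → Circle}
  {H₁ : Type*} [NormedAddCommGroup H₁] [InnerProductSpace ℂ H₁] [CompleteSpace H₁]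
  {H₂ : Type*} [NormedAddCommGroup H₂] [InnerProductSpace ℂ H₂] [CompleteSpace H₂]
  {π₁ : ProjRep G H₁ c} {L₁ : Submodule ℂ H₁} [CompleteSpace L₁]
  {π₂ : ProjRep G H₂ c} {L₂ : Submodule ℂ H₂} [CompleteSpace L₂]

theorem diagonal_op_apply (g : G) (Y : HS H₁ H₂) (x : H₁) :
    ((diagonal π₁ π₂).toFun g Y).op x = π₂.toFun g (Y.op ((π₁.toFun g).symm x)) := rfl

theorem diagonal_symm_op_apply (g : G) (Y : HS H₁ H₂) (x : H₁) :
    (((diagonal π₁ π₂).toFun g).symm Y).op x = (π₂.toFun g).symm (Y.op (π₁.toFun g x)) := rfl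

theorem isWandering_diagonal (hc : ∀ γ ∈ Γ, ∀ γ' ∈ Γ, c γ γ' = 1) (hL₁ : IsWandering π₁ Γ L₁) :
    IsWandering (diagonal π₁ π₂) Γ (rightSupported H₂ L₁) := by
  have hc1 : c 1 1 = 1 := hc 1 Γ.one_mem 1 Γ.one_mem
  refine ⟨fun γ hγ hne Y hY Z hZ => ?_, ?_⟩
  · refine (hL₁.hasSum_hs_inner hc1 hZ _).unique ?_
    convert hasSum_zero with i
    rw [diagonal_op_apply, π₁.symm_eq_inv hc hγ, hY _ (hL₁.map_mem_orthogonal (Γ.inv_mem hγ)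
      (inv_ne_one.2 hne) (Subtype.property _)), map_zero, inner_zero_left]
  · rw [Submodule.topologicalClosure_eq_top_iff, Submodule.eq_bot_iff]
    intro Z hZ
    -- if `Z` is orthogonal to `π(γ) Y` for all `Y` with `Y = Y P_{L₁}`, then `π(γ)⁻¹ Z` vanishes on
    -- `L₁`, that is `Z` vanishes on `π₁(γ) L₁`
    have key : ∀ γ : Γ, (rightSupported H₂ L₁).orthogonalProjectionOnto
        (((diagonal π₁ π₂).toFun γ).symm Z) = 0 := by
      intro γ
      refine orthogonalProjectionOnto_eq_zero_of_inner fun Y hY => ?_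
      rw [← LinearIsometryEquiv.inner_map_eq_flip]
      exact (Submodule.mem_orthogonal _ _).1 hZ _ ((le_iSup (fun γ : Γ => (rightSupported H₂ L₁).map
        ((diagonal π₁ π₂).toFun γ).toLinearEquiv.toLinearMap) γ) ⟨Y, hY, rfl⟩)
    have hz : Z.op = 0 := by
      refine hL₁.clm_ext fun γ l hl => ?_
      have h := key γ
      rw [hL₁.orthogonalProjectionOnto_rightSupported hc1] at h
      have h' := congrArg (fun Y : rightSupported H₂ L₁ => (Y : HS H₁ H₂).op l) h
      simp only [toRight_op_of_mem _ _ hl, diagonal_symm_op_apply] at h'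
      exact (π₂.toFun γ).symm.injective (h'.trans (map_zero _).symm)
    exact HS.ext fun x => by rw [hz]; rfl

theorem hsSq_comp_starProjection_eq_trace (hc : c 1 1 = 1) (hL₁ : IsWandering π₁ Γ L₁)
    (X : H₁ →L[ℂ] H₂) :
    hsSq (X ∘L L₁.starProjection) = trace L₁ (ContinuousLinearMap.adjoint X ∘L X) := by
  rw [hL₁.hsSq_comp_starProjection hc, trace_adjoint_comp]

/-- The trace property of `τ`: both sides are `∑ |⟪π₂(γ) fⱼ, X eᵢ⟫|²`, summed over `γ ∈ Γ` and over
bases `(eᵢ)` of `L₁` and `(fⱼ)` of `L₂`. -/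
theorem trace_adjoint_comp_comm (hc : ∀ γ ∈ Γ, ∀ γ' ∈ Γ, c γ γ' = 1) (hL₁ : IsWandering π₁ Γ L₁)
    (hL₂ : IsWandering π₂ Γ L₂) {X : H₁ →L[ℂ] H₂} (hX : X ∈ intertwiners π₁ π₂ Γ) :
    trace L₁ (ContinuousLinearMap.adjoint X ∘L X) =
      trace L₂ (X ∘L ContinuousLinearMap.adjoint X) := by
  have h2 := trace_adjoint_comp (L := L₂) (ContinuousLinearMap.adjoint X)
  rw [ContinuousLinearMap.adjoint_adjoint] at h2
  rw [trace_adjoint_comp, h2]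
  simp_rw [hL₂.enorm_sq_eq_tsum (X _), hL₁.enorm_sq_eq_tsum (ContinuousLinearMap.adjoint X _)]
  have e : ∀ (γ : Γ) (i : basisIdx L₁) (j : basisIdx L₂),
      ‖⟪π₁.toFun γ (stdBasis L₁ i : H₁), ContinuousLinearMap.adjoint X (stdBasis L₂ j : H₂)⟫_ℂ‖ₑ =
        ‖⟪π₂.toFun (γ⁻¹ : Γ) (stdBasis L₂ j : H₂), X (stdBasis L₁ i : H₁)⟫_ℂ‖ₑ := by
    intro γ i j
    rw [ContinuousLinearMap.adjoint_inner_right, hX γ γ.2, LinearIsometryEquiv.inner_map_eq_flip,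
      π₂.symm_eq_inv hc γ.2, ← inner_conj_symm, RCLike.enorm_conj]
    rfl
  simp_rw [e]
  rw [ENNReal.tsum_comm]
  conv_rhs => rw [ENNReal.tsum_comm]
  rw [← (Equiv.inv Γ).tsum_eq]
  simp only [Equiv.inv_apply]
  refine tsum_congr fun γ => ?_
  rw [ENNReal.tsum_comm]

omit [CompleteSpace H₂] in
theorem hasSum_conjOp_comp_starProjection (hL₁ : IsWandering π₁ Γ L₁) {X : H₁ →L[ℂ] H₂}
    (hX : X ∈ intertwiners π₁ π₂ Γ) (x : H₁) :
    HasSum (fun γ : Γ => conjOp π₁ π₂ γ (X ∘L L₁.starProjection) x) (X x) := by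
  have h := (hL₁.hasSum_proj x).mapL X
  simp_rw [hX _ (Subtype.property _)] at h
  exact h

/-- For `B ∈ B(L₁, L₂)` and `γ₀ ∈ Γ`, the operator `π₁(γ) l ↦ π₂(γ) π₂(γ₀) B l`; this is the
convolutor `ρ(γ₀) ⊗ B` on `ℓ²(Γ)`. -/
theorem exists_elementary_intertwiner (hc : ∀ γ ∈ Γ, ∀ γ' ∈ Γ, c γ γ' = 1)
    (hL₁ : IsWandering π₁ Γ L₁) (hL₂ : IsWandering π₂ Γ L₂) (γ₀ : Γ) (B : L₁ →L[ℂ] L₂) :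
    ∃ X ∈ intertwiners π₁ π₂ Γ, ∀ l : L₁, X l = π₂.toFun γ₀ (B l : H₂) := by
  classical
  -- the isometries `π₂(γγ₀)` of `L₂` are those of the Hilbert sum, permuted by `γ ↦ γγ₀`
  have hV := hL₂.isHilbertSum.OrthogonalFamily.comp (mul_left_injective γ₀)
  let X : H₁ →L[ℂ] H₂ := hV.linearIsometry.toContinuousLinearMap ∘L
    lp.mapCLM 2 (fun _ : Γ => B) (norm_nonneg B) (fun _ => le_rfl) ∘L
      hL₁.equiv.toContinuousLinearEquiv.toContinuousLinearMap
  have hX : ∀ (γ : Γ) (l : L₁), X (π₁.toFun γ l) = π₂.toFun (γ * γ₀ : Γ) (B l : H₂) := by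
    intro γ l
    have e1 : hL₁.equiv (π₁.toFun γ l) = lp.single 2 γ l := by
      rw [← hL₁.equiv_symm_single, LinearIsometryEquiv.apply_symm_apply]
    have e2 : lp.mapCLM 2 (fun _ : Γ => B) (norm_nonneg B) (fun _ => le_rfl)
        (lp.single 2 γ l) = lp.single 2 γ (B l) := by
      refine lp.ext (funext fun γ' => ?_)
      change B ((lp.single 2 γ l : lp (fun _ : Γ => L₁) 2) γ') =
        (lp.single 2 γ (B l) : lp (fun _ : Γ => L₂) 2) γ'
      rw [lp.single_apply, lp.single_apply, Pi.single_apply, Pi.single_apply]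
      split_ifs <;> simp
    change hV.linearIsometry (lp.mapCLM 2 (fun _ : Γ => B) (norm_nonneg B) (fun _ => le_rfl)
      (hL₁.equiv (π₁.toFun γ l))) = _
    rw [e1, e2, hV.linearIsometry_apply_single]
    rfl
  refine ⟨X, mem_intertwiners_iff_conjOp.2 fun γ hγ => hL₁.clm_ext fun h l hl => ?_, fun l => ?_⟩
  · have h1 := hX (⟨γ, hγ⟩⁻¹ * h) ⟨l, hl⟩
    simp only [Subgroup.coe_mul, Subgroup.coe_inv] at h1
    rw [conjOp_apply, π₁.symm_eq_inv hc hγ, π₁.mul_apply_of_mem hc (Γ.inv_mem hγ) h.2, h1,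
      π₂.mul_apply_of_mem hc hγ (Γ.mul_mem (Γ.mul_mem (Γ.inv_mem hγ) h.2) γ₀.2), hX h ⟨l, hl⟩]
    congr 2
    simp [mul_assoc]
  · have h1 := hX 1 l
    rwa [OneMemClass.coe_one, π₁.map_one_apply (hc 1 Γ.one_mem 1 Γ.one_mem), one_mul] at h1

/-- The finite-rank vectors `X P_{L₁}`, with `X` an intertwiner, are total in the wandering
subspace; rank one is enough. -/
theorem dense_of_finiteRank_mem (hc : ∀ γ ∈ Γ, ∀ γ' ∈ Γ, c γ γ' = 1) (hL₁ : IsWandering π₁ Γ L₁)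
    (hL₂ : IsWandering π₂ Γ L₂) {K : Submodule ℂ (rightSupported H₂ L₁)}
    (hK : ∀ X ∈ intertwiners π₁ π₂ Γ, ∀ h : IsHS (X ∘L L₁.starProjection),
      FiniteDimensional ℂ (X ∘L L₁.starProjection).range → toRight L₁ X h ∈ K) :
    Dense (K : Set (rightSupported H₂ L₁)) := by
  classical
  have hc1 : c 1 1 = 1 := hc 1 Γ.one_mem 1 Γ.one_mem
  rw [Submodule.dense_iff_topologicalClosure_eq_top, Submodule.topologicalClosure_eq_top_iff,
    Submodule.eq_bot_iff]
  intro Z hZ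
  have key : ∀ i, (Z : HS H₁ H₂).op (stdBasis L₁ i : H₁) = 0 := by
    intro i
    refine hL₂.eq_zero fun γ₀ m hm => ?_
    obtain ⟨X, hX, hXl⟩ := exists_elementary_intertwiner hc hL₁ hL₂ γ₀
      (InnerProductSpace.rankOne ℂ (⟨m, hm⟩ : L₂) (stdBasis L₁ i))
    have hXl' : ∀ l : L₁, X l = ⟪stdBasis L₁ i, l⟫_ℂ • π₂.toFun γ₀ m := by
      intro l
      rw [hXl, InnerProductSpace.rankOne_apply, Submodule.coe_smul, map_smul]
    have horth := orthonormal_iff_ite.1 (stdBasis L₁).orthonormal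
    have hHS : IsHS (X ∘L L₁.starProjection) := by
      rw [IsHS, hL₁.hsSq_comp_starProjection hc1, tsum_eq_single i]
      · exact ENNReal.pow_lt_top enorm_lt_top
      · intro j hj
        rw [hXl', horth, if_neg (Ne.symm hj)]
        simp
    have hfin : FiniteDimensional ℂ (X ∘L L₁.starProjection).range := by
      have hle : (X ∘L L₁.starProjection).range ≤ Submodule.span ℂ {π₂.toFun γ₀ m} := by
        rintro _ ⟨x, rfl⟩
        exact Submodule.mem_span_singleton.2 ⟨_, (hXl' (L₁.orthogonalProjectionOnto x)).symm⟩
      exact Submodule.finiteDimensional_of_le hle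
    have h0 := (Submodule.mem_orthogonal _ _).1 hZ _ (hK X hX hHS hfin)
    have hs := hL₁.hasSum_hs_inner hc1 Z.2 (toRight L₁ X hHS : HS H₁ H₂)
    rw [← Submodule.coe_inner, h0] at hs
    have hi := (hasSum_single i fun j hj => ?_).unique hs
    · rwa [toRight_op_of_mem _ _ (Subtype.property _), hXl', horth, if_pos rfl, one_smul] at hi
    · rw [toRight_op_of_mem _ _ (Subtype.property _), hXl', horth, if_neg (Ne.symm hj), zero_smul,
        inner_zero_left]
  have hzz := hL₁.hasSum_hs_inner hc1 Z.2 (Z : HS H₁ H₂)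
  simp_rw [key, inner_zero_left] at hzz
  exact Subtype.ext (inner_self_eq_zero.1 (hzz.unique hasSum_zero))

variable (Γ π₁ L₁ π₂) in
/-- The intertwiners `X` with `X P_{L₁}` Hilbert–Schmidt, that is with `τ(X* X) < ∞`. -/
noncomputable def hsIntertwiners : Submodule ℂ (H₁ →L[ℂ] H₂) where
  carrier := {X | X ∈ intertwiners π₁ π₂ Γ ∧ IsHS (X ∘L L₁.starProjection)}
  add_mem' := fun {X Y} hX hY => ⟨(intertwiners π₁ π₂ Γ).add_mem hX.1 hY.1, by
    rw [ContinuousLinearMap.add_comp]; exact (hsSubmodule H₁ H₂).add_mem hX.2 hY.2⟩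
  zero_mem' := ⟨(intertwiners π₁ π₂ Γ).zero_mem, by
    rw [ContinuousLinearMap.zero_comp]; exact (hsSubmodule H₁ H₂).zero_mem⟩
  smul_mem' := fun a X hX => ⟨(intertwiners π₁ π₂ Γ).smul_mem a hX.1, by
    rw [ContinuousLinearMap.smul_comp]; exact (hsSubmodule H₁ H₂).smul_mem a hX.2⟩

variable (Γ π₁ L₁ π₂) in
/-- `X ↦ X P_{L₁}`, as a linear map to the wandering subspace. -/
noncomputable def hsIntertwinersToRight :
    hsIntertwiners Γ π₁ L₁ π₂ →ₗ[ℂ] rightSupported H₂ L₁ where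
  toFun X := toRight L₁ X X.2.2
  map_add' _ _ := rfl
  map_smul' _ _ := rfl

theorem hsIntertwinersToRight_apply (X : hsIntertwiners Γ π₁ L₁ π₂) :
    hsIntertwinersToRight Γ π₁ L₁ π₂ X = toRight L₁ X.1 X.2.2 := rfl

theorem denseRange_hsIntertwinersToRight (hc : ∀ γ ∈ Γ, ∀ γ' ∈ Γ, c γ γ' = 1)
    (hL₁ : IsWandering π₁ Γ L₁) (hL₂ : IsWandering π₂ Γ L₂) :
    DenseRange (hsIntertwinersToRight Γ π₁ L₁ π₂) := by
  have h := dense_of_finiteRank_mem hc hL₁ hL₂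
    (K := LinearMap.range (hsIntertwinersToRight Γ π₁ L₁ π₂))
    fun X hX h _ => ⟨⟨X, hX, h⟩, rfl⟩
  rwa [LinearMap.coe_range] at h

/-! ### Boundedness of the Hecke operator in the Hilbert–Schmidt norm -/

/-- Parseval's identity holds along each left coset `gΓ`. The set `(tΓ)⁻¹`, with `t ∈ ΓσΓ`, is
contained in the union of the finitely many left cosets in `Γσ⁻¹Γ`; this is where almost normality
gives the bound. -/
theorem IsWandering.tsum_enorm_sq_coset_le (hΓ : IsAlmostNormal Γ) (hL₁ : IsWandering π₁ Γ L₁)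
    {σ t : G} (ht : t ∈ DoubleCoset.doubleCoset σ (Γ : Set G) Γ) (x : H₁) :
    ∑' γ : Γ, ‖L₁.orthogonalProjectionOnto (π₁.toFun (t * γ) x)‖ₑ ^ 2 ≤
      (hΓ.finite_heckeCosets σ⁻¹).toFinset.card * ‖x‖ₑ ^ 2 := by
  have hcoset : ∀ g : G, ∑' γ : Γ,
      ‖L₁.orthogonalProjectionOnto ((π₁.toFun (g * γ)).symm x)‖ₑ ^ 2 = ‖x‖ₑ ^ 2 := by
    intro g
    have h := hL₁.tsum_enorm_sq ((π₁.toFun g).symm x)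
    rw [← ofReal_norm ((π₁.toFun g).symm x), LinearIsometryEquiv.norm_map, ofReal_norm] at h
    rw [← h]
    refine tsum_congr fun γ => ?_
    rw [← ofReal_norm, π₁.norm_clm_symm_mul, ofReal_norm]
  set F := (hΓ.finite_heckeCosets σ⁻¹).toFinset with hF
  have hmem : ∀ γ : Γ, ((t * γ)⁻¹ : G) ∈ DoubleCoset.doubleCoset σ⁻¹ (Γ : Set G) Γ := fun γ =>
    inv_mem_doubleCoset_inv.2 ((mul_mem_doubleCoset_right γ.2).2 ht)
  -- `f γ` is the position of `(tγ)⁻¹` among the left cosets in `Γσ⁻¹Γ`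
  let f : Γ → F × Γ := fun γ => (⟨((t * γ)⁻¹ : G), by
      rw [hF, Set.Finite.mem_toFinset]; exact mk_mem_heckeCosets.2 (hmem γ)⟩,
    ⟨(((t * γ)⁻¹ : G) : G ⧸ Γ).out⁻¹ * (t * γ)⁻¹,
      QuotientGroup.eq.1 (QuotientGroup.out_eq' _)⟩)
  have hf : ∀ γ : Γ, ((f γ).1 : G ⧸ Γ).out * (f γ).2 = (t * γ : G)⁻¹ := fun γ =>
    mul_inv_cancel_left _ _
  have hinj : Function.Injective f := by
    intro γ γ' h
    have h' := hf γ
    rw [h, hf γ'] at h'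
    exact Subtype.ext (mul_left_cancel (inv_injective h')).symm
  calc ∑' γ : Γ, ‖L₁.orthogonalProjectionOnto (π₁.toFun (t * γ) x)‖ₑ ^ 2
      = ∑' γ : Γ, ‖L₁.orthogonalProjectionOnto
          ((π₁.toFun (((f γ).1 : G ⧸ Γ).out * (f γ).2)).symm x)‖ₑ ^ 2 := by
        refine tsum_congr fun γ => ?_
        rw [hf, ← ofReal_norm, ← ofReal_norm, π₁.norm_clm_symm_inv]
    _ ≤ ∑' p : F × Γ, ‖L₁.orthogonalProjectionOnto
          ((π₁.toFun ((p.1 : G ⧸ Γ).out * p.2)).symm x)‖ₑ ^ 2 :=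
        ENNReal.tsum_comp_le_tsum_of_injective hinj (fun p : F × Γ =>
          ‖L₁.orthogonalProjectionOnto ((π₁.toFun ((p.1 : G ⧸ Γ).out * p.2)).symm x)‖ₑ ^ 2)
    _ = F.card * ‖x‖ₑ ^ 2 := by
        refine (ENNReal.tsum_prod (f := fun (q : F) (γ : Γ) => ‖L₁.orthogonalProjectionOnto
          ((π₁.toFun ((q : G ⧸ Γ).out * γ)).symm x)‖ₑ ^ 2)).trans ?_
        simp_rw [hcoset]
        simp

/-- Conjugation by `t ∈ ΓσΓ` is bounded for the `L²`-norm of intertwiners. The Hilbert–Schmidt norm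
of `π₂(t) X π₁(t)⁻¹ P_{L₁}` is that of `P_{L₁} π₁(t) X*`, which is computed in the basis `π₂(γ) fⱼ`
of `H₂` and estimated by sums over cosets of the vectors `X* fⱼ`. -/
theorem hsSq_conjOp_comp_starProjection_le (hΓ : IsAlmostNormal Γ)
    (hc : ∀ γ ∈ Γ, ∀ γ' ∈ Γ, c γ γ' = 1) (hL₁ : IsWandering π₁ Γ L₁) (hL₂ : IsWandering π₂ Γ L₂)
    {X : H₁ →L[ℂ] H₂} (hX : X ∈ intertwiners π₁ π₂ Γ) {σ t : G}
    (ht : t ∈ DoubleCoset.doubleCoset σ (Γ : Set G) Γ) :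
    hsSq (conjOp π₁ π₂ t X ∘L L₁.starProjection) ≤
      (hΓ.finite_heckeCosets σ⁻¹).toFinset.card * hsSq (X ∘L L₁.starProjection) := by
  have h2 := trace_adjoint_comp (L := L₂) (ContinuousLinearMap.adjoint X)
  rw [ContinuousLinearMap.adjoint_adjoint, ← trace_adjoint_comp_comm hc hL₁ hL₂ hX,
    ← hsSq_comp_starProjection_eq_trace (hc 1 Γ.one_mem 1 Γ.one_mem) hL₁] at h2
  have e : hsSq (conjOp π₁ π₂ t X ∘L L₁.starProjection) = hsSq (L₁.starProjection ∘L
      (π₁.toFun t).toContinuousLinearEquiv.toContinuousLinearMap ∘L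
        ContinuousLinearMap.adjoint X) := by
    have e1 := hsSq_conj (π₂.toFun t) (LinearIsometryEquiv.refl ℂ H₁)
      (X ∘L (π₁.toFun t).symm.toContinuousLinearEquiv.toContinuousLinearMap ∘L L₁.starProjection)
    refine e1.trans ?_
    rw [← hsSq_adjoint]
    congr 1
    symm
    rw [ContinuousLinearMap.eq_adjoint_iff]
    intro y x
    change ⟪L₁.starProjection (π₁.toFun t (ContinuousLinearMap.adjoint X y)), x⟫_ℂ =
      ⟪y, X ((π₁.toFun t).symm (L₁.starProjection x))⟫_ℂ
    rw [Submodule.inner_starProjection_left_eq_right, LinearIsometryEquiv.inner_map_eq_flip,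
      ContinuousLinearMap.adjoint_inner_left]
  have hX' : ∀ (γ : Γ) (y : H₂), ContinuousLinearMap.adjoint X (π₂.toFun γ y) =
      π₁.toFun γ (ContinuousLinearMap.adjoint X y) := by
    intro γ y
    refine ext_inner_right ℂ fun x => ?_
    rw [ContinuousLinearMap.adjoint_inner_left, LinearIsometryEquiv.inner_map_eq_flip,
      LinearIsometryEquiv.inner_map_eq_flip, ContinuousLinearMap.adjoint_inner_left,
      π₂.symm_eq_inv hc γ.2, π₁.symm_eq_inv hc γ.2, hX _ (Γ.inv_mem γ.2)]
  rw [e, hL₂.hsSq_eq_tsum, ENNReal.tsum_comm, h2, ← ENNReal.tsum_mul_left]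
  refine ENNReal.tsum_le_tsum fun j => le_trans (ENNReal.tsum_le_tsum fun γ => le_of_eq ?_)
    (hL₁.tsum_enorm_sq_coset_le hΓ ht _)
  rw [ContinuousLinearMap.comp_apply, ContinuousLinearMap.comp_apply, hX']
  change ‖L₁.starProjection (π₁.toFun t (π₁.toFun γ _))‖ₑ ^ 2 = _
  rw [π₁.mul_apply, map_smul, ← ofReal_norm, norm_smul, Circle.norm_coe, one_mul, ofReal_norm]
  rfl

end L2Intertwiners

/-! ### The bounded Hecke operator on the `L²`-space of intertwiners -/

section HeckeL2

variable {G : Type*} [Group G] {Γ : Subgroup G} {c : G → G → Circle}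
  {H₁ : Type*} [NormedAddCommGroup H₁] [InnerProductSpace ℂ H₁] [CompleteSpace H₁]
  {H₂ : Type*} [NormedAddCommGroup H₂] [InnerProductSpace ℂ H₂] [CompleteSpace H₂]
  {π₁ : ProjRep G H₁ c} {L₁ : Submodule ℂ H₁} [CompleteSpace L₁]
  {π₂ : ProjRep G H₂ c} {L₂ : Submodule ℂ H₂} [CompleteSpace L₂]

theorem enorm_sq_toRight (X : H₁ →L[ℂ] H₂) (h : IsHS (X ∘L L₁.starProjection)) :
    ‖toRight L₁ X h‖ₑ ^ 2 = hsSq (X ∘L L₁.starProjection) :=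
  HS.enorm_sq (toRight L₁ X h : HS H₁ H₂)

theorem isHS_conjOp_comp_starProjection (hΓ : IsAlmostNormal Γ)
    (hc : ∀ γ ∈ Γ, ∀ γ' ∈ Γ, c γ γ' = 1) (hL₁ : IsWandering π₁ Γ L₁) (hL₂ : IsWandering π₂ Γ L₂)
    {X : H₁ →L[ℂ] H₂} (hX : X ∈ intertwiners π₁ π₂ Γ) (h : IsHS (X ∘L L₁.starProjection)) (t : G) :
    IsHS (conjOp π₁ π₂ t X ∘L L₁.starProjection) :=
  (hsSq_conjOp_comp_starProjection_le hΓ hc hL₁ hL₂ hX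
    (DoubleCoset.mem_doubleCoset_self Γ Γ t)).trans_lt (ENNReal.mul_lt_top (ENNReal.natCast_lt_top _) h)

theorem norm_toRight_conjOp_le (hΓ : IsAlmostNormal Γ)
    (hc : ∀ γ ∈ Γ, ∀ γ' ∈ Γ, c γ γ' = 1) (hL₁ : IsWandering π₁ Γ L₁) (hL₂ : IsWandering π₂ Γ L₂)
    {X : H₁ →L[ℂ] H₂} (hX : X ∈ intertwiners π₁ π₂ Γ) (h : IsHS (X ∘L L₁.starProjection)) {σ t : G}
    (ht : t ∈ DoubleCoset.doubleCoset σ (Γ : Set G) Γ) :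
    ‖toRight L₁ (conjOp π₁ π₂ t X) (isHS_conjOp_comp_starProjection hΓ hc hL₁ hL₂ hX h t)‖ ≤
      Real.sqrt (hΓ.finite_heckeCosets σ⁻¹).toFinset.card * ‖toRight L₁ X h‖ := by
  have hle := hsSq_conjOp_comp_starProjection_le hΓ hc hL₁ hL₂ hX ht
  rw [← enorm_sq_toRight X h, ← enorm_sq_toRight _
    (isHS_conjOp_comp_starProjection hΓ hc hL₁ hL₂ hX h t), enorm_sq_eq_ofReal, enorm_sq_eq_ofReal,
    ← ENNReal.ofReal_natCast, ← ENNReal.ofReal_mul (by positivity),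
    ENNReal.ofReal_le_ofReal_iff (by positivity)] at hle
  rw [← Real.sqrt_sq (norm_nonneg (toRight L₁ X h)), ← Real.sqrt_mul (by positivity)]
  exact Real.le_sqrt_of_sq_le hle

theorem isHS_hecke_comp_starProjection (hΓ : IsAlmostNormal Γ)
    (hc : ∀ γ ∈ Γ, ∀ γ' ∈ Γ, c γ γ' = 1) (hL₁ : IsWandering π₁ Γ L₁) (hL₂ : IsWandering π₂ Γ L₂)
    {X : H₁ →L[ℂ] H₂} (hX : X ∈ intertwiners π₁ π₂ Γ) (h : IsHS (X ∘L L₁.starProjection)) (σ : G) :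
    IsHS (hecke π₁ π₂ Γ σ X ∘L L₁.starProjection) := by
  rw [hecke_eq_sum hΓ, ContinuousLinearMap.finsetSum_comp]
  exact (hsSubmodule H₁ H₂).sum_mem fun q _ =>
    isHS_conjOp_comp_starProjection hΓ hc hL₁ hL₂ hX h q.out

theorem toRight_hecke (hΓ : IsAlmostNormal Γ)
    (hc : ∀ γ ∈ Γ, ∀ γ' ∈ Γ, c γ γ' = 1) (hL₁ : IsWandering π₁ Γ L₁) (hL₂ : IsWandering π₂ Γ L₂)
    {X : H₁ →L[ℂ] H₂} (hX : X ∈ intertwiners π₁ π₂ Γ) (h : IsHS (X ∘L L₁.starProjection)) (σ : G) :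
    toRight L₁ (hecke π₁ π₂ Γ σ X) (isHS_hecke_comp_starProjection hΓ hc hL₁ hL₂ hX h σ) =
      ∑ q ∈ (hΓ.finite_heckeCosets σ).toFinset, toRight L₁ (conjOp π₁ π₂ q.out X)
        (isHS_conjOp_comp_starProjection hΓ hc hL₁ hL₂ hX h q.out) := by
  refine rightSupported_ext fun l hl => ?_
  let ev : rightSupported H₂ L₁ →+ H₂ :=
    { toFun := fun Y => (Y : HS H₁ H₂).op l, map_zero' := rfl, map_add' := fun _ _ => rfl }
  have hev : ∀ (Y : H₁ →L[ℂ] H₂) (hY : IsHS (Y ∘L L₁.starProjection)),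
      ev (toRight L₁ Y hY) = Y l := fun Y hY => toRight_op_of_mem Y hY hl
  change ev _ = ev _
  rw [map_sum]
  simp_rw [hev]
  rw [hecke_eq_sum hΓ, sum_apply]

variable (π₁ π₂ L₁) in
/-- The Hecke operator on the intertwiners with `τ(X* X) < ∞`, with values in the wandering
subspace. -/
noncomputable def heckeToRight (hΓ : IsAlmostNormal Γ)
    (hc : ∀ γ ∈ Γ, ∀ γ' ∈ Γ, c γ γ' = 1) (hL₁ : IsWandering π₁ Γ L₁) (hL₂ : IsWandering π₂ Γ L₂)
    (σ : G) : hsIntertwiners Γ π₁ L₁ π₂ →ₗ[ℂ] rightSupported H₂ L₁ where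
  toFun X := toRight L₁ (hecke π₁ π₂ Γ σ X)
    (isHS_hecke_comp_starProjection hΓ hc hL₁ hL₂ X.2.1 X.2.2 σ)
  map_add' X Y := rightSupported_ext fun l hl => by
    change _ = ((toRight L₁ _ _ : rightSupported H₂ L₁) : HS H₁ H₂).op l +
      ((toRight L₁ _ _ : rightSupported H₂ L₁) : HS H₁ H₂).op l
    simp only [toRight_op_of_mem _ _ hl, hecke_eq_sum hΓ, Submodule.coe_add, conjOp_add,
      Finset.sum_add_distrib, add_apply]
  map_smul' a X := rightSupported_ext fun l hl => by
    change _ = a • ((toRight L₁ _ _ : rightSupported H₂ L₁) : HS H₁ H₂).op l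
    simp only [toRight_op_of_mem _ _ hl, hecke_eq_sum hΓ, Submodule.coe_smul, conjOp_smul,
      ← Finset.smul_sum, smul_apply]

theorem heckeToRight_apply (hΓ : IsAlmostNormal Γ)
    (hc : ∀ γ ∈ Γ, ∀ γ' ∈ Γ, c γ γ' = 1) (hL₁ : IsWandering π₁ Γ L₁) (hL₂ : IsWandering π₂ Γ L₂)
    (σ : G) (X : hsIntertwiners Γ π₁ L₁ π₂) :
    heckeToRight π₁ L₁ π₂ hΓ hc hL₁ hL₂ σ X = toRight L₁ (hecke π₁ π₂ Γ σ X.1)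
      (isHS_hecke_comp_starProjection hΓ hc hL₁ hL₂ X.2.1 X.2.2 σ) := rfl

theorem norm_heckeToRight_le (hΓ : IsAlmostNormal Γ)
    (hc : ∀ γ ∈ Γ, ∀ γ' ∈ Γ, c γ γ' = 1) (hL₁ : IsWandering π₁ Γ L₁) (hL₂ : IsWandering π₂ Γ L₂)
    (σ : G) : ∃ C, ∀ X : hsIntertwiners Γ π₁ L₁ π₂, ‖heckeToRight π₁ L₁ π₂ hΓ hc hL₁ hL₂ σ X‖ ≤
      C * ‖hsIntertwinersToRight Γ π₁ L₁ π₂ X‖ := by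
  refine ⟨(hΓ.finite_heckeCosets σ).toFinset.card *
    Real.sqrt (hΓ.finite_heckeCosets σ⁻¹).toFinset.card, fun X => ?_⟩
  rw [heckeToRight_apply, hsIntertwinersToRight_apply, toRight_hecke hΓ hc hL₁ hL₂ X.2.1 X.2.2 σ,
    mul_assoc, ← nsmul_eq_mul, ← Finset.sum_const]
  refine norm_sum_le_of_le _ fun q hq => ?_
  have hq' : q ∈ heckeCosets Γ σ := (Set.Finite.mem_toFinset _).1 hq
  exact norm_toRight_conjOp_le hΓ hc hL₁ hL₂ X.2.1 X.2.2 hq'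

variable (π₁ π₂ L₁) in
/-- The bounded extension of the Hecke operator to the wandering subspace. -/
noncomputable def heckeL2 (hΓ : IsAlmostNormal Γ)
    (hc : ∀ γ ∈ Γ, ∀ γ' ∈ Γ, c γ γ' = 1) (hL₁ : IsWandering π₁ Γ L₁) (hL₂ : IsWandering π₂ Γ L₂)
    (σ : G) : rightSupported H₂ L₁ →L[ℂ] rightSupported H₂ L₁ :=
  (heckeToRight π₁ L₁ π₂ hΓ hc hL₁ hL₂ σ).extendOfNorm (hsIntertwinersToRight Γ π₁ L₁ π₂)

theorem heckeL2_toRight (hΓ : IsAlmostNormal Γ)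
    (hc : ∀ γ ∈ Γ, ∀ γ' ∈ Γ, c γ γ' = 1) (hL₁ : IsWandering π₁ Γ L₁) (hL₂ : IsWandering π₂ Γ L₂)
    (σ : G) {X : H₁ →L[ℂ] H₂} (hX : X ∈ intertwiners π₁ π₂ Γ)
    (h : IsHS (X ∘L L₁.starProjection)) :
    heckeL2 π₁ L₁ π₂ hΓ hc hL₁ hL₂ σ (toRight L₁ X h) = toRight L₁ (hecke π₁ π₂ Γ σ X)
      (isHS_hecke_comp_starProjection hΓ hc hL₁ hL₂ hX h σ) := by
  have e := LinearMap.extendOfNorm_eq (f := heckeToRight π₁ L₁ π₂ hΓ hc hL₁ hL₂ σ)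
    (e := hsIntertwinersToRight Γ π₁ L₁ π₂) (denseRange_hsIntertwinersToRight hc hL₁ hL₂)
    (norm_heckeToRight_le hΓ hc hL₁ hL₂ σ) ⟨X, hX, h⟩
  rw [heckeToRight_apply, hsIntertwinersToRight_apply] at e
  exact e

/-! ### Convergence of the series over the double coset -/

omit [CompleteSpace H₂] in
theorem hsSq_rankOne (x : H₂) (y : H₁) :
    hsSq (InnerProductSpace.rankOne ℂ x y) = ‖y‖ₑ ^ 2 * ‖x‖ₑ ^ 2 := by
  rw [hsSq, ← parseval (stdBasis H₁) y, ← ENNReal.tsum_mul_right]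
  refine tsum_congr fun i => ?_
  rw [InnerProductSpace.rankOne_apply, enorm_smul, mul_pow, ← inner_conj_symm, RCLike.enorm_conj]

omit [CompleteSpace H₂] in
theorem isHS_rankOne (x : H₂) (y : H₁) : IsHS (InnerProductSpace.rankOne ℂ x y) := by
  rw [IsHS, hsSq_rankOne]
  exact ENNReal.mul_lt_top (ENNReal.pow_lt_top enorm_lt_top) (ENNReal.pow_lt_top enorm_lt_top)

variable (H₁ H₂) in
theorem HS.op_sum {ι : Type*} (s : Finset ι) (z : ι → HS H₁ H₂) :
    (∑ i ∈ s, z i).op = ∑ i ∈ s, (z i).op :=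
  map_sum (HS.opL (H₁ := H₁) (H₂ := H₂)) z s

/-- If `(v i)` is orthonormal and `∑ ‖b i‖² < ∞`, the rank-one operators
`y ↦ ⟪b i, y⟫ X (v i)` are summable in Hilbert–Schmidt norm. -/
theorem summable_rankOne {ι : Type*} (X : H₁ →L[ℂ] H₂) {v b : ι → H₁} (hv : Orthonormal ℂ v)
    (hb : Summable fun i => ‖b i‖ ^ 2) :
    Summable fun i => (HS.mk (InnerProductSpace.rankOne ℂ (X (v i)) (b i)) (isHS_rankOne _ _) :
      HS H₁ H₂) := by
  set z : ι → HS H₁ H₂ := fun i =>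
    HS.mk (InnerProductSpace.rankOne ℂ (X (v i)) (b i)) (isHS_rankOne _ _) with hz
  have hbound : ∀ s : Finset ι, ‖∑ i ∈ s, z i‖ ^ 2 ≤ ‖X‖ ^ 2 * ∑ i ∈ s, ‖b i‖ ^ 2 := by
    intro s
    have hop : ∀ y, (∑ i ∈ s, z i).op y = X (∑ i ∈ s, ⟪b i, y⟫_ℂ • v i) := by
      intro y
      rw [HS.op_sum, sum_apply, map_sum]
      simp_rw [map_smul]
      rfl
    -- Pythagoras
    have hpyth : ∀ y, ‖∑ i ∈ s, ⟪b i, y⟫_ℂ • v i‖ₑ ^ 2 = ∑ i ∈ s, ‖⟪b i, y⟫_ℂ‖ₑ ^ 2 := by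
      intro y
      have h := hv.orthogonalFamily.norm_sum (fun i => ⟪b i, y⟫_ℂ) s
      simp_rw [enorm_sq_eq_ofReal]
      rw [← ENNReal.ofReal_sum_of_nonneg (fun _ _ => by positivity), ← h]
      rfl
    have h : ‖∑ i ∈ s, z i‖ₑ ^ 2 ≤ ‖X‖ₑ ^ 2 * ∑ i ∈ s, ‖b i‖ₑ ^ 2 := by
      rw [HS.enorm_sq, hsSq]
      calc ∑' k, ‖(∑ i ∈ s, z i).op (stdBasis H₁ k)‖ₑ ^ 2
          ≤ ∑' k, ‖X‖ₑ ^ 2 * ∑ i ∈ s, ‖⟪b i, stdBasis H₁ k⟫_ℂ‖ₑ ^ 2 := by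
            refine ENNReal.tsum_le_tsum fun k => ?_
            rw [hop, ← hpyth]
            exact enorm_clm_apply_sq_le X _
        _ = ‖X‖ₑ ^ 2 * ∑ i ∈ s, ‖b i‖ₑ ^ 2 := by
            rw [ENNReal.tsum_mul_left, Summable.tsum_finsetSum fun _ _ => ENNReal.summable]
            congr 1
            refine Finset.sum_congr rfl fun i _ => ?_
            rw [← parseval (stdBasis H₁) (b i)]
            refine tsum_congr fun k => ?_
            rw [← inner_conj_symm, RCLike.enorm_conj]
    simp_rw [enorm_sq_eq_ofReal] at h
    rwa [← ENNReal.ofReal_sum_of_nonneg (fun _ _ => by positivity),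
      ← ENNReal.ofReal_mul (by positivity),
      ENNReal.ofReal_le_ofReal_iff (by positivity)] at h
  have hb' := hb.mul_left (‖X‖ ^ 2)
  rw [summable_iff_vanishing_norm] at hb' ⊢
  intro ε hε
  obtain ⟨s, hs⟩ := hb' (ε ^ 2) (by positivity)
  refine ⟨s, fun t ht => lt_of_pow_lt_pow_left₀ 2 hε.le ((hbound t).trans_lt ?_)⟩
  rw [Finset.mul_sum]
  exact (Real.le_norm_self _).trans_lt (hs t ht)

omit [CompleteSpace H₂] in
/-- A finite-rank operator
`X P_L` is a finite sum of operators `y ↦ ⟪l k, y⟫ X (l k)` with `(l k)` orthonormal in `L`. -/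
theorem exists_orthonormal_of_finiteRank (X : H₁ →L[ℂ] H₂)
    (hfin : FiniteDimensional ℂ (X ∘L L₁.starProjection).range) :
    ∃ (n : ℕ) (l : Fin n → H₁), Orthonormal ℂ l ∧ (∀ k, l k ∈ L₁) ∧
      ∀ y, X (L₁.starProjection y) = ∑ k, ⟪l k, y⟫_ℂ • X (l k) := by
  set T := X ∘L L₁.starProjection with hT
  set N : Submodule ℂ H₁ := LinearMap.ker T.toLinearMap with hN
  have hNc : IsClosed (N : Set H₁) := T.isClosed_ker
  have : CompleteSpace N := hNc.completeSpace_coe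
  -- `(l k)` will be an orthonormal basis of the orthogonal complement of the kernel
  have hLN : Nᗮ ≤ L₁ := by
    rw [← L₁.orthogonal_orthogonal]
    refine Submodule.orthogonal_le fun x hx => ?_
    change X (L₁.starProjection x) = 0
    rw [L₁.starProjection_apply_eq_zero_iff.2 hx, map_zero]
  have hK : FiniteDimensional ℂ Nᗮ := by
    refine FiniteDimensional.of_injective (T.toLinearMap.rangeRestrict ∘ₗ Nᗮ.subtype) ?_
    rw [injective_iff_map_eq_zero]
    intro x hx
    have hx' : (x : H₁) ∈ N := congrArg Subtype.val hx
    have : ⟪(x : H₁), x⟫_ℂ = 0 := (Submodule.mem_orthogonal _ _).1 x.2 _ hx'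
    exact Subtype.ext (inner_self_eq_zero.1 this)
  let b := stdOrthonormalBasis ℂ Nᗮ
  refine ⟨_, fun k => b k, b.orthonormal.comp_linearIsometry Nᗮ.subtypeₗᵢ, fun k => hLN (b k).2,
    fun y => ?_⟩
  have h1 : T y = T (Nᗮ.starProjection y) := by
    have h := N.starProjection_add_starProjection_orthogonal y
    have h0 : T (N.starProjection y) = 0 := N.starProjection_apply_mem y
    conv_lhs => rw [← h, map_add, h0, zero_add]
  have h2 : Nᗮ.starProjection y = ∑ k, ⟪(b k : H₁), y⟫_ℂ • (b k : H₁) := by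
    have h := b.sum_repr (Nᗮ.orthogonalProjectionOnto y)
    rw [← Submodule.coe_orthogonalProjectionOnto_apply, ← h, Submodule.coe_sum]
    refine Finset.sum_congr rfl fun k _ => ?_
    rw [b.repr_apply_apply, inner_coe_orthogonalProjectionOnto, Submodule.coe_smul]
  change T y = _
  rw [h1, h2, map_sum]
  refine Finset.sum_congr rfl fun k _ => ?_
  rw [map_smul, hT, ContinuousLinearMap.comp_apply,
    Submodule.starProjection_eq_self_iff.2 (hLN (b k).2)]

end HeckeL2

section CharacterValue

variable {G : Type*} [Group G] {Γ : Subgroup G} {c : G → G → Circle}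
  {H₁ : Type*} [NormedAddCommGroup H₁] [InnerProductSpace ℂ H₁] [CompleteSpace H₁]
  {H₂ : Type*} [NormedAddCommGroup H₂] [InnerProductSpace ℂ H₂] [CompleteSpace H₂]
  {π₁ : ProjRep G H₁ c} {L₁ : Submodule ℂ H₁} [CompleteSpace L₁]
  {π₂ : ProjRep G H₂ c} {L₂ : Submodule ℂ H₂} [CompleteSpace L₂]

omit [CompleteSpace H₁] [CompleteSpace L₁] in
theorem IsWandering.orthonormal_map (hL₁ : IsWandering π₁ Γ L₁) {l : H₁} (hl : l ∈ L₁)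
    (hl1 : ‖l‖ = 1) : Orthonormal ℂ fun γ : Γ => π₁.toFun γ l :=
  ⟨fun γ => by rw [LinearIsometryEquiv.norm_map, hl1], fun γ γ' hne =>
    hL₁.inner_eq_zero (QuotientGroup.eq.2 (Γ.mul_mem (Γ.inv_mem γ.2) γ'.2))
      (fun h => hne (Subtype.ext h)) hl hl⟩

theorem IsWandering.summable_norm_sq_coset (hΓ : IsAlmostNormal Γ) (hL₁ : IsWandering π₁ Γ L₁)
    (t : G) (x : H₁) :
    Summable fun γ : Γ => ‖L₁.starProjection (π₁.toFun t (π₁.toFun γ x))‖ ^ 2 := by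
  have h := hL₁.tsum_enorm_sq_coset_le hΓ (DoubleCoset.mem_doubleCoset_self Γ Γ t) x
  have h' := ne_top_of_le_ne_top
    (ENNReal.mul_ne_top (ENNReal.natCast_ne_top _) (ENNReal.pow_ne_top enorm_ne_top)) h
  have hs := (memℓp_gen_iff (by norm_num : 0 < (2 : ℝ≥0∞).toReal)).1 
    (memℓp_two_iff_enorm (E := fun _ : Γ => L₁).2 h')
  refine hs.congr fun γ => ?_
  rw [π₁.mul_apply, map_smul, norm_smul, Circle.norm_coe, one_mul]
  simp

/-- The `θ`-term of the series, at a vector `X P_{L₁}`. -/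
theorem series_diagonal_toRight (hc : ∀ γ ∈ Γ, ∀ γ' ∈ Γ, c γ γ' = 1) (hL₁ : IsWandering π₁ Γ L₁)
    (A : Set G) (Y : rightSupported H₂ L₁) {θ : G} (hθ : θ ∈ A) :
    series (diagonal π₁ π₂) (rightSupported H₂ L₁) A θ Y =
      toRight L₁ ((diagonal π₁ π₂).toFun θ (Y : HS H₁ H₂)).op
        (isHS_op_comp_starProjection ((diagonal π₁ π₂).toFun θ Y)) := by
  rw [series, Set.indicator_of_mem hθ]
  exact hL₁.orthogonalProjectionOnto_rightSupported (hc 1 Γ.one_mem 1 Γ.one_mem)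
    ((diagonal π₁ π₂).toFun θ Y)

/-- The sum over one coset `tΓ`, in Hilbert–Schmidt norm. Writing `X P_{L₁}` as a sum of operators
`⟪l, ·⟫ X l`, the `tγ`-term becomes a sum of the operators
`⟪P_{L₁} π₁(t) π₁(γ) l, ·⟫ π₂(t) X π₁(γ) l`; the vectors `π₁(γ) l` are orthonormal and the vectors
`P_{L₁} π₁(t) π₁(γ) l` are square-summable. The limit is known from the strong convergence of
`∑ π₂(γ) X P_{L₁} π₁(γ)⁻¹` to `X`. -/
theorem hasSum_coset (hΓ : IsAlmostNormal Γ)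
    (hc : ∀ γ ∈ Γ, ∀ γ' ∈ Γ, c γ γ' = 1) (hL₁ : IsWandering π₁ Γ L₁) (hL₂ : IsWandering π₂ Γ L₂)
    {X : H₁ →L[ℂ] H₂} (hX : X ∈ intertwiners π₁ π₂ Γ) (h : IsHS (X ∘L L₁.starProjection))
    (hfin : FiniteDimensional ℂ (X ∘L L₁.starProjection).range) (t : G) :
    HasSum (fun γ : Γ => toRight L₁ ((diagonal π₁ π₂).toFun (t * γ) (toRight L₁ X h)).op
        (isHS_op_comp_starProjection ((diagonal π₁ π₂).toFun (t * γ) (toRight L₁ X h))))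
      (toRight L₁ (conjOp π₁ π₂ t X)
        (isHS_conjOp_comp_starProjection hΓ hc hL₁ hL₂ hX h t)) := by
  set z : Γ → rightSupported H₂ L₁ := fun γ =>
    toRight L₁ ((diagonal π₁ π₂).toFun (t * γ) (toRight L₁ X h)).op
      (isHS_op_comp_starProjection ((diagonal π₁ π₂).toFun (t * γ) (toRight L₁ X h)))
  have hzy : ∀ γ y, (z γ : HS H₁ H₂).op y =
      π₂.toFun t (conjOp π₁ π₂ γ (X ∘L L₁.starProjection)
        ((π₁.toFun t).symm (L₁.starProjection y))) := by
    intro γ y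
    have e : (z γ : HS H₁ H₂).op y =
      conjOp π₁ π₂ (t * γ) (X ∘L L₁.starProjection) (L₁.starProjection y) := rfl
    rw [e, ← conjOp_conjOp]
    rfl
  obtain ⟨n, l, hl, hlL, hXl⟩ := exists_orthonormal_of_finiteRank X hfin
  let X' : H₁ →L[ℂ] H₂ := (π₂.toFun t).toContinuousLinearEquiv.toContinuousLinearMap ∘L X
  let w : Fin n → Γ → HS H₁ H₂ := fun k γ => HS.mk (InnerProductSpace.rankOne ℂ
    (X' (π₁.toFun γ (l k))) (L₁.starProjection (π₁.toFun t (π₁.toFun γ (l k))))) (isHS_rankOne _ _)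
  have hzw : ∀ γ, (z γ : HS H₁ H₂) = ∑ k, w k γ := by
    intro γ
    refine HS.ext fun y => ?_
    rw [hzy, HS.op_sum, sum_apply, conjOp_apply, ContinuousLinearMap.comp_apply, hXl, map_sum,
      map_sum]
    refine Finset.sum_congr rfl fun k _ => ?_
    have e : ⟪l k, (π₁.toFun γ).symm ((π₁.toFun t).symm (L₁.starProjection y))⟫_ℂ =
        ⟪L₁.starProjection (π₁.toFun t (π₁.toFun γ (l k))), y⟫_ℂ := by
      rw [Submodule.inner_starProjection_left_eq_right, LinearIsometryEquiv.inner_map_eq_flip,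
        LinearIsometryEquiv.inner_map_eq_flip]
    rw [e, map_smul, map_smul, ← hX γ γ.2]
    rfl
  have hsum : Summable fun γ => (z γ : HS H₁ H₂) := by
    simp_rw [hzw]
    exact summable_sum fun k _ => summable_rankOne X' (hL₁.orthonormal_map (hlL k) (hl.1 k))
      (hL₁.summable_norm_sq_coset hΓ t (l k))
  obtain ⟨W, hW⟩ := hsum
  have hWeq : W = (toRight L₁ (conjOp π₁ π₂ t X)
      (isHS_conjOp_comp_starProjection hΓ hc hL₁ hL₂ hX h t) : HS H₁ H₂) := by
    refine HS.ext fun y => ?_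
    have h1 : HasSum (fun γ => (z γ : HS H₁ H₂).op y) (W.op y) :=
      hW.mapL ((ContinuousLinearMap.apply ℂ H₂ y) ∘L (HS.opL (H₁ := H₁) (H₂ := H₂)))
    have h2 := (hasSum_conjOp_comp_starProjection hL₁ hX
      ((π₁.toFun t).symm (L₁.starProjection y))).mapL
      (π₂.toFun t).toContinuousLinearEquiv.toContinuousLinearMap
    simp_rw [hzy] at h1
    exact h1.unique h2
  rw [hWeq] at hW
  exact (Topology.IsInducing.subtypeVal.hasSum_iff
    (g := (rightSupported H₂ L₁).subtype) z _).1 hW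

theorem hasSum_series_toRight (hΓ : IsAlmostNormal Γ)
    (hc : ∀ γ ∈ Γ, ∀ γ' ∈ Γ, c γ γ' = 1) (hL₁ : IsWandering π₁ Γ L₁) (hL₂ : IsWandering π₂ Γ L₂)
    (σ : G) {X : H₁ →L[ℂ] H₂} (hX : X ∈ intertwiners π₁ π₂ Γ)
    (h : IsHS (X ∘L L₁.starProjection))
    (hfin : FiniteDimensional ℂ (X ∘L L₁.starProjection).range) :
    HasSum (fun θ => series (diagonal π₁ π₂) (rightSupported H₂ L₁)
      (DoubleCoset.doubleCoset σ Γ Γ) θ (toRight L₁ X h))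
      (heckeL2 π₁ L₁ π₂ hΓ hc hL₁ hL₂ σ (toRight L₁ X h)) := by
  classical
  rw [heckeL2_toRight hΓ hc hL₁ hL₂ σ hX h, toRight_hecke hΓ hc hL₁ hL₂ hX h]
  set f : G → rightSupported H₂ L₁ := fun θ => series (diagonal π₁ π₂) (rightSupported H₂ L₁)
    (DoubleCoset.doubleCoset σ Γ Γ) θ (toRight L₁ X h) with hf
  have hsplit : ∀ θ, f θ = ∑ q ∈ (hΓ.finite_heckeCosets σ).toFinset,
      if (θ : G ⧸ Γ) = q then f θ else 0 := by
    intro θ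
    rw [Finset.sum_ite_eq]
    split_ifs with hθ
    · rfl
    · have hθ' : θ ∉ DoubleCoset.doubleCoset σ (Γ : Set G) Γ := fun hD =>
        hθ ((Set.Finite.mem_toFinset _).2 (mk_mem_heckeCosets.2 hD))
      simp only [hf]
      rw [series, Set.indicator_of_notMem hθ']
      rfl
  rw [show f = _ from funext hsplit]
  refine hasSum_sum fun q hq => ?_
  have hq' : q ∈ heckeCosets Γ σ := (Set.Finite.mem_toFinset _).1 hq
  have hinj : Function.Injective fun γ : Γ => q.out * (γ : G) :=
    fun γ γ' e => Subtype.ext (mul_left_cancel e)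
  rw [← hinj.hasSum_iff]
  · convert hasSum_coset hΓ hc hL₁ hL₂ hX h hfin q.out using 1
    funext γ
    have hmk : ((q.out * γ : G) : G ⧸ Γ) = q := by
      rw [QuotientGroup.mk_mul_of_mem _ γ.2, QuotientGroup.out_eq']
    rw [Function.comp_apply, if_pos hmk]
    exact series_diagonal_toRight hc hL₁ _ _ ((mul_mem_doubleCoset_right γ.2).2 hq')
  · intro θ hθ
    refine if_neg fun e => hθ ⟨⟨q.out⁻¹ * θ, QuotientGroup.eq.1 ?_⟩, mul_inv_cancel_left _ _⟩
    rw [QuotientGroup.out_eq', e]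

theorem clm_ext_of_finiteRank (hc : ∀ γ ∈ Γ, ∀ γ' ∈ Γ, c γ γ' = 1) (hL₁ : IsWandering π₁ Γ L₁)
    (hL₂ : IsWandering π₂ Γ L₂) {F : Type*} [NormedAddCommGroup F] [NormedSpace ℂ F]
    {S T : rightSupported H₂ L₁ →L[ℂ] F}
    (hST : ∀ X ∈ intertwiners π₁ π₂ Γ, ∀ h : IsHS (X ∘L L₁.starProjection),
      FiniteDimensional ℂ (X ∘L L₁.starProjection).range →
        S (toRight L₁ X h) = T (toRight L₁ X h)) : S = T := by
  have hd := dense_of_finiteRank_mem hc hL₁ hL₂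
    (K := LinearMap.eqLocus S.toLinearMap T.toLinearMap) hST
  exact ContinuousLinearMap.coeFn_injective (S.continuous.ext_on hd T.continuous fun x hx => hx)

omit [CompleteSpace L₁] in
/-- The diagonal representation is unitary, so the adjoint of the `θ`-term is the `θ⁻¹`-term. -/
theorem inner_series_diagonal (σ θ : G) (Z Y : rightSupported H₂ L₁) :
    ⟪Z, series (diagonal π₁ π₂) (rightSupported H₂ L₁)
      (DoubleCoset.doubleCoset σ (Γ : Set G) Γ) θ Y⟫_ℂ =
    ⟪series (diagonal π₁ π₂) (rightSupported H₂ L₁)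
      (DoubleCoset.doubleCoset σ⁻¹ (Γ : Set G) Γ) θ⁻¹ Z, Y⟫_ℂ := by
  by_cases hθ : θ ∈ DoubleCoset.doubleCoset σ (Γ : Set G) Γ
  · rw [series, series, Set.indicator_of_mem hθ,
      Set.indicator_of_mem (inv_mem_doubleCoset_inv.2 hθ)]
    change ⟪Z, (rightSupported H₂ L₁).orthogonalProjectionOnto ((diagonal π₁ π₂).toFun θ Y)⟫_ℂ =
      ⟪(rightSupported H₂ L₁).orthogonalProjectionOnto ((diagonal π₁ π₂).toFun θ⁻¹ Z), Y⟫_ℂ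
    rw [inner_coe_orthogonalProjectionOnto, ← inner_conj_symm _ Y,
      inner_coe_orthogonalProjectionOnto, inner_conj_symm,
      ← (diagonal π₁ π₂).symm_eq_inv (Γ := ⊤) (fun _ _ _ _ => rfl) (Subgroup.mem_top θ),
      ← inner_conj_symm, LinearIsometryEquiv.inner_map_eq_flip, inner_conj_symm]
  · rw [series, series, Set.indicator_of_notMem hθ,
      Set.indicator_of_notMem (fun h => hθ (inv_mem_doubleCoset_inv.1 h))]
    simp

omit [CompleteSpace L₁] in
theorem hasSum_inner_series_of_hasSum {σ : G} {Z W : rightSupported H₂ L₁}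
    (h : HasSum (fun θ => series (diagonal π₁ π₂) (rightSupported H₂ L₁)
      (DoubleCoset.doubleCoset σ⁻¹ (Γ : Set G) Γ) θ Z) W) (Y : rightSupported H₂ L₁) :
    HasSum (fun θ => ⟪Z, series (diagonal π₁ π₂) (rightSupported H₂ L₁)
      (DoubleCoset.doubleCoset σ (Γ : Set G) Γ) θ Y⟫_ℂ) ⟪W, Y⟫_ℂ := by
  simp_rw [inner_series_diagonal]
  have h1 := ((h.mapL (innerSL ℂ Y)).star)
  rw [← (Equiv.inv G).hasSum_iff] at h1
  have e : ∀ V : rightSupported H₂ L₁, ⟪V, Y⟫_ℂ = star (innerSL ℂ Y V) :=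
    fun V => (inner_conj_symm V Y).symm
  simp_rw [e]
  exact h1

/-- The `L²`-Hecke operators of `ΓσΓ` and `Γσ⁻¹Γ` are adjoint to each other. -/
theorem heckeL2_adjoint (hΓ : IsAlmostNormal Γ)
    (hc : ∀ γ ∈ Γ, ∀ γ' ∈ Γ, c γ γ' = 1) (hL₁ : IsWandering π₁ Γ L₁) (hL₂ : IsWandering π₂ Γ L₂)
    (σ : G) :
    ContinuousLinearMap.adjoint (heckeL2 π₁ L₁ π₂ hΓ hc hL₁ hL₂ σ) =
      heckeL2 π₁ L₁ π₂ hΓ hc hL₁ hL₂ σ⁻¹ := by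
  -- for finite-rank `Y` and `Z` both sides are the sum of the `⟪Z, P_L π(θ) Y⟫`; density extends this
  -- to all `Y`, then to all `Z`
  refine clm_ext_of_finiteRank hc hL₁ hL₂ fun Z hZ hZs hZf => ?_
  set z := toRight L₁ Z hZs
  have hz := hasSum_series_toRight hΓ hc hL₁ hL₂ σ⁻¹ hZ hZs hZf
  have key : innerSL ℂ (heckeL2 π₁ L₁ π₂ hΓ hc hL₁ hL₂ σ⁻¹ z) =
      innerSL ℂ z ∘L heckeL2 π₁ L₁ π₂ hΓ hc hL₁ hL₂ σ := by
    refine clm_ext_of_finiteRank hc hL₁ hL₂ fun Y hY hYs hYf => ?_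
    have hy := (hasSum_series_toRight hΓ hc hL₁ hL₂ σ hY hYs hYf).mapL (innerSL ℂ z)
    exact (hasSum_inner_series_of_hasSum hz (toRight L₁ Y hYs)).unique hy
  refine ext_inner_right ℂ fun Y => ?_
  rw [ContinuousLinearMap.adjoint_inner_left]
  exact (congrArg (fun T => T Y) key).symm

theorem hasSum_inner_series (hΓ : IsAlmostNormal Γ)
    (hc : ∀ γ ∈ Γ, ∀ γ' ∈ Γ, c γ γ' = 1) (hL₁ : IsWandering π₁ Γ L₁) (hL₂ : IsWandering π₂ Γ L₂)
    (σ : G) {X : H₁ →L[ℂ] H₂} (hX : X ∈ intertwiners π₁ π₂ Γ)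
    (h : IsHS (X ∘L L₁.starProjection))
    (hfin : FiniteDimensional ℂ (X ∘L L₁.starProjection).range) (Y : rightSupported H₂ L₁) :
    HasSum (fun θ => ⟪toRight L₁ X h, series (diagonal π₁ π₂) (rightSupported H₂ L₁)
      (DoubleCoset.doubleCoset σ (Γ : Set G) Γ) θ Y⟫_ℂ)
      ⟪toRight L₁ X h, heckeL2 π₁ L₁ π₂ hΓ hc hL₁ hL₂ σ Y⟫_ℂ := by
  rw [← ContinuousLinearMap.adjoint_inner_left, heckeL2_adjoint]
  exact hasSum_inner_series_of_hasSum (hasSum_series_toRight hΓ hc hL₁ hL₂ σ⁻¹ hX h hfin) Y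

theorem isCharacterValue_heckeL2 (hΓ : IsAlmostNormal Γ)
    (hc : ∀ γ ∈ Γ, ∀ γ' ∈ Γ, c γ γ' = 1) (hL₁ : IsWandering π₁ Γ L₁) (hL₂ : IsWandering π₂ Γ L₂)
    (σ : G) :
    IsCharacterValue (series (diagonal π₁ π₂) (rightSupported H₂ L₁)
      (DoubleCoset.doubleCoset σ Γ Γ)) (heckeL2 π₁ L₁ π₂ hΓ hc hL₁ hL₂ σ) := by
  let K : Submodule ℂ (rightSupported H₂ L₁) :=
    { carrier := {v | HasSum (fun θ => series (diagonal π₁ π₂) (rightSupported H₂ L₁)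
        (DoubleCoset.doubleCoset σ Γ Γ) θ v) (heckeL2 π₁ L₁ π₂ hΓ hc hL₁ hL₂ σ v)}
      add_mem' := fun {v w} hv hw => by
        simp only [Set.mem_ofPred_eq, map_add] at *
        exact hv.add hw
      zero_mem' := by
        simp only [Set.mem_ofPred_eq, map_zero]
        exact hasSum_zero
      smul_mem' := fun a v hv => by
        simp only [Set.mem_ofPred_eq, map_smul] at *
        exact hv.const_smul a }
  exact dense_of_finiteRank_mem hc hL₁ hL₂ (K := K) fun X hX h hfin =>
    hasSum_series_toRight hΓ hc hL₁ hL₂ σ hX h hfin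

end CharacterValue

end HeckeRep

theorem mainTheorem3 {G : Type*} [Group G] (Γ : Subgroup G) (hΓ : IsAlmostNormal Γ)
    {c : G → G → Circle} (hc : ∀ γ ∈ Γ, ∀ γ' ∈ Γ, c γ γ' = 1)
    {H₁ : Type*} [NormedAddCommGroup H₁] [InnerProductSpace ℂ H₁] [CompleteSpace H₁]
    {H₂ : Type*} [NormedAddCommGroup H₂] [InnerProductSpace ℂ H₂] [CompleteSpace H₂]
    (π₁ : ProjRep G H₁ c) (π₂ : ProjRep G H₂ c)
    (L₁ : Submodule ℂ H₁) [CompleteSpace L₁] (hL₁ : IsWandering π₁ Γ L₁)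
    (L₂ : Submodule ℂ H₂) [CompleteSpace L₂] (hL₂ : IsWandering π₂ Γ L₂)
    (σ : G) :
    -- the Hecke operator on intertwiners, by any decomposition of the double coset
    (∃ (n : ℕ) (s : Fin n → G), IsCosetDecomposition Γ σ s) ∧
    (∀ (n : ℕ) (s : Fin n → G), IsCosetDecomposition Γ σ s → ∀ X ∈ intertwiners π₁ π₂ Γ,
      hecke π₁ π₂ Γ σ X = ∑ i, conjOp π₁ π₂ (s i * σ) X) ∧
    (∀ X ∈ intertwiners π₁ π₂ Γ, hecke π₁ π₂ Γ σ X ∈ intertwiners π₁ π₂ Γ) ∧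
    -- the wandering subspace of the diagonal representation is the `L²`-space of intertwiners
    IsWandering (diagonal π₁ π₂) Γ (rightSupported H₂ L₁) ∧
    (∀ X ∈ intertwiners π₁ π₂ Γ,
      hsSq (X ∘L L₁.starProjection) = trace L₁ (ContinuousLinearMap.adjoint X ∘L X) ∧
      trace L₁ (ContinuousLinearMap.adjoint X ∘L X) =
        trace L₂ (X ∘L ContinuousLinearMap.adjoint X) ∧
      ∀ x, HasSum (fun γ : Γ => conjOp π₁ π₂ γ (X ∘L L₁.starProjection) x) (X x)) ∧
    Dense {Y : rightSupported H₂ L₁ | ∃ X ∈ intertwiners π₁ π₂ Γ,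
      ∃ h : IsHS (X ∘L L₁.starProjection), toRight L₁ X h = Y} ∧
    -- the bounded extension of the Hecke operator to the `L²`-space is `ε̃ (S (ΓσΓ))`
    (∃ Ψ : rightSupported H₂ L₁ →L[ℂ] rightSupported H₂ L₁,
      (∀ X ∈ intertwiners π₁ π₂ Γ, ∀ h : IsHS (X ∘L L₁.starProjection),
        ∃ h' : IsHS (hecke π₁ π₂ Γ σ X ∘L L₁.starProjection),
          Ψ (toRight L₁ X h) = toRight L₁ (hecke π₁ π₂ Γ σ X) h') ∧
      IsCharacterValue (series (diagonal π₁ π₂) (rightSupported H₂ L₁)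
        (DoubleCoset.doubleCoset σ Γ Γ)) Ψ ∧
      (∀ X ∈ intertwiners π₁ π₂ Γ, ∀ h : IsHS (X ∘L L₁.starProjection),
        FiniteDimensional ℂ (X ∘L L₁.starProjection).range →
        HasSum (fun θ => series (diagonal π₁ π₂) (rightSupported H₂ L₁)
          (DoubleCoset.doubleCoset σ Γ Γ) θ (toRight L₁ X h)) (Ψ (toRight L₁ X h)) ∧
        ∀ Y : rightSupported H₂ L₁,
          HasSum (fun θ => inner ℂ (toRight L₁ X h) (series (diagonal π₁ π₂)
            (rightSupported H₂ L₁) (DoubleCoset.doubleCoset σ Γ Γ) θ Y))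
            (inner ℂ (toRight L₁ X h) (Ψ Y)))) ∧
    -- the identification of the intertwiners with `R(Γ) ⊗ B(L₁, L₂)`
    (∀ X : H₁ →L[ℂ] H₂, X ∈ intertwiners π₁ π₂ Γ ↔
      ∃ A : Γ → L₁ →L[ℂ] L₂, Represents (fun _ _ => 1) A (transport hL₁ hL₂ X)) ∧
    (∀ X ∈ intertwiners π₁ π₂ Γ,
      Represents (fun _ _ => 1) (intCoeff π₂ Γ L₁ L₂ X) (transport hL₁ hL₂ X)) ∧
    -- the formula by the conditional expectation
    (∃ S₁ S₂, Represents c (series π₁ L₁ (DoubleCoset.doubleCoset σ Γ Γ)) S₁ ∧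
      Represents c (series π₁ L₁ (DoubleCoset.doubleCoset σ⁻¹ Γ Γ))
        (ContinuousLinearMap.adjoint S₁) ∧
      Represents c (series π₂ L₂ (DoubleCoset.doubleCoset σ Γ Γ)) S₂ ∧
      ∀ X ∈ intertwiners π₁ π₂ Γ, ∃ X',
        Represents c (extendZero Γ (intCoeff π₂ Γ L₁ L₂ X)) X' ∧
        transport hL₁ hL₂ (hecke π₁ π₂ Γ σ X) =
          condExp Γ (S₂ ∘L X' ∘L ContinuousLinearMap.adjoint S₁) ∧
        (DoubleCoset.doubleCoset σ⁻¹ (Γ : Set G) Γ = DoubleCoset.doubleCoset σ Γ Γ →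
          transport hL₁ hL₂ (hecke π₁ π₂ Γ σ X) = condExp Γ (S₂ ∘L X' ∘L S₁))) := by
  have hc1 : c 1 1 = 1 := hc 1 Γ.one_mem 1 Γ.one_mem
  refine ⟨hΓ.exists_isCosetDecomposition σ,
    fun n s hs X hX => hecke_eq_sum_of_isCosetDecomposition hΓ hX hs,
    fun X hX => hecke_mem_intertwiners hΓ σ hX,
    isWandering_diagonal hc hL₁,
    fun X hX => ⟨hsSq_comp_starProjection_eq_trace hc1 hL₁ X,
      trace_adjoint_comp_comm hc hL₁ hL₂ hX, hasSum_conjOp_comp_starProjection hL₁ hX⟩,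
    ?_, ⟨heckeL2 π₁ L₁ π₂ hΓ hc hL₁ hL₂ σ, ?_, ?_, ?_⟩,
    fun X => ⟨fun hX => ⟨_, represents_transport hc hL₁ hL₂ hX⟩,
      fun ⟨A, hA⟩ => mem_intertwiners_of_represents hc hL₁ hL₂ hA⟩,
    fun X hX => represents_transport hc hL₁ hL₂ hX,
    cosetTransport hL₁ hL₁ (heckeMatrix hΓ σ H₁), cosetTransport hL₂ hL₂ (heckeMatrix hΓ σ H₂),
    represents_series hΓ hL₁ σ, ?_, represents_series hΓ hL₂ σ, fun X hX =>
    ⟨cosetTransport hL₁ hL₂ (diagonalConj π₁ π₂ Γ X), represents_extendZero hL₁ hL₂ hX,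
      transport_hecke hΓ hL₁ hL₂ σ X, fun hσ => ?_⟩⟩
  · refine (denseRange_hsIntertwinersToRight hc hL₁ hL₂).mono ?_
    rintro _ ⟨X, rfl⟩
    exact ⟨X.1, X.2.1, X.2.2, rfl⟩
  · exact fun X hX h => ⟨_, heckeL2_toRight hΓ hc hL₁ hL₂ σ hX h⟩
  · exact isCharacterValue_heckeL2 hΓ hc hL₁ hL₂ σ
  · exact fun X hX h hfin => ⟨hasSum_series_toRight hΓ hc hL₁ hL₂ σ hX h hfin,
      hasSum_inner_series hΓ hc hL₁ hL₂ σ hX h hfin⟩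
  · rw [cosetTransport_adjoint, heckeMatrix_adjoint]
    exact represents_series hΓ hL₁ σ⁻¹
  · rw [transport_hecke hΓ hL₁ hL₂ σ X, cosetTransport_adjoint, heckeMatrix_adjoint,
      heckeMatrix_congr hΓ hσ]
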